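/- All vector spaces are over $\mathbb{Q}$. Let $(\Lambda(U,V),d)$ be a \emph{two-stage minimal model}: $U$ and $V$ are finite-dimensional graded vector spaces concentrated in positive degrees, $\Lambda(U,V)=\Lambda(U\oplus V)$ is the free graded commutative algebra on $U\oplus V$, and $d$ is a differential (a derivation of degree $+1$ with $d^2=0$) with $d(U)=0$, $d(V)\subseteq\Lambda U$ and no linear term. Assume that it is \emph{elliptic}, i.e. $\dim H(\Lambda(U,V),d)<\infty$, that $d(V)\subseteq\Lambda^2U$, and that $V$ \emph{has maximal dimension}: for every two-stage minimal model $(\Lambda(U',V'),d')$ isomorphic to $(\Lambda(U,V),d)$ as a differential graded algebra, $\dim V'\le\dim V$. Call a graded vector space $W$ $n$-\emph{connected} if $W^i=0$ for $i\le n$, and $n$-\emph{co-connected} if $W^i=0$ for $i\ge n$. Assume that one of the following holds: (A) for some integer $r$, $U^{\mathrm{odd}}$ is $(2r-1)$-connected and $U^{\mathrm{even}}$ is $(2r+2)$-co-connected; (B) for some integer $s$, $U^{\mathrm{odd}}$ is $(2s+1)$-co-connected and $U^{\mathrm{even}}$ is $(4s-4)$-connected. Then $$\mathrm{rk}_0\big(\Lambda(U,V)\big)\le\dim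 V-\dim U^{\mathrm{even}}.$$ Here the \emph{rational toral rank} $\mathrm{rk}_0(\Lambda W)$ of $(\Lambda W,d)$ is the largest $n$ for which there is a Koszul–Sullivan extension $(\Lambda A_n,0)\to(\Lambda A_n\otimes\Lambda W,D)\to(\Lambda W,d)$ with $A_n=\langle a_1,\dots,a_n\rangle$, $|a_i|=2$, and $\dim H(\Lambda A_n\otimes\Lambda W,D)<\infty$. Such an extension consists of a differential $D$ on $\Lambda A_n\otimes\Lambda W$ with $D(a_i)=0$ that induces $d$ on $\Lambda W$ modulo the ideal generated by $A_n$, such that $W$ has an ordered homogeneous basis $w_1,w_2,\dots$ with $Dw_i\in\Lambda A_n\otimes\Lambda(w_1,\dots,w_{i-1})$. -/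

import Mathlib

noncomputable section

/-! # Free graded commutative algebras over `ℚ`

A finite-dimensional graded rational vector space `W` is given by a homogeneous basis: a finite
index type `ι` together with the degrees `deg : ι → ℕ` of the basis elements.
`FreeGCA deg` is the free graded commutative algebra `ΛW`. -/

/-- The relations of graded commutativity `x y = (-1)^{|x||y|} y x` between generators. (For a
generator `x` of odd degree this gives `2 x² = 0`, that is `x² = 0`.) -/
inductive FreeGCA.Rel {ι : Type*} (deg : ι → ℕ) : FreeAlgebra ℚ ι → FreeAlgebra ℚ ι → Prop
  | comm (i j : ι) : FreeGCA.Rel deg (FreeAlgebra.ι ℚ i * FreeAlgebra.ι ℚ j)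
      ((-1 : ℚ) ^ (deg i * deg j) • (FreeAlgebra.ι ℚ j * FreeAlgebra.ι ℚ i))

/-- `ΛW`: the tensor algebra on `W` modulo graded commutativity. -/
def FreeGCA {ι : Type*} (deg : ι → ℕ) : Type _ := RingQuot (FreeGCA.Rel deg)

namespace FreeGCA

variable {ι : Type*} {κ : Type*}

instance instRing (deg : ι → ℕ) : Ring (FreeGCA deg) :=
  inferInstanceAs (Ring (RingQuot (Rel deg)))

instance instAlgebra (deg : ι → ℕ) : Algebra ℚ (FreeGCA deg) :=
  inferInstanceAs (Algebra ℚ (RingQuot (Rel deg)))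

/-- The quotient map from the free algebra on the generators. -/
def mk (deg : ι → ℕ) : FreeAlgebra ℚ ι →ₐ[ℚ] FreeGCA deg := RingQuot.mkAlgHom ℚ (Rel deg)

/-- The generator of `ΛW` that belongs to an index. -/
def gen (deg : ι → ℕ) (i : ι) : FreeGCA deg :=
  mk deg (FreeAlgebra.ι ℚ i)

/-- The universal property of `ΛW`. -/
def lift (deg : ι → ℕ) {B : Type*} [Ring B] [Algebra ℚ B] (f : ι → B)
    (hf : ∀ i j, f i * f j = (-1 : ℚ) ^ (deg i * deg j) • (f j * f i)) : FreeGCA deg →ₐ[ℚ] B :=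
  RingQuot.liftAlgHom ℚ ⟨FreeAlgebra.lift ℚ f, by
    rintro _ _ ⟨i, j⟩
    simpa using hf i j⟩

theorem gen_mul_gen (deg : ι → ℕ) (i j : ι) :
    gen deg i * gen deg j = (-1 : ℚ) ^ (deg i * deg j) • (gen deg j * gen deg i) := by
  have h : mk deg _ = mk deg _ := RingQuot.mkAlgHom_rel ℚ (Rel.comm (deg := deg) i j)
  rw [map_mul, map_smul, map_mul] at h
  exact h

@[simp]
theorem lift_gen (deg : ι → ℕ) {B : Type*} [Ring B] [Algebra ℚ B] (f : ι → B)
    (hf : ∀ i j, f i * f j = (-1 : ℚ) ^ (deg i * deg j) • (f j * f i)) (i : ι) :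
    lift deg f hf (gen deg i) = f i := by
  have h : lift deg f hf (mk deg (FreeAlgebra.ι ℚ i)) = FreeAlgebra.lift ℚ f (FreeAlgebra.ι ℚ i) :=
    RingQuot.liftAlgHom_mkAlgHom_apply ℚ _ _ _
  simpa [gen] using h

/-- The linear span of the monomials (products of lists of generators) that satisfy `P`. -/
def monomialSpan (deg : ι → ℕ) (P : List ι → Prop) : Submodule ℚ (FreeGCA deg) :=
  Submodule.span ℚ {x | ∃ l : List ι, P l ∧ x = (l.map (gen deg)).prod}

/-- The homogeneous elements of degree `k` in `ΛW`. -/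
def degreePart (deg : ι → ℕ) (k : ℕ) : Submodule ℚ (FreeGCA deg) :=
  monomialSpan deg fun l => (l.map deg).sum = k

/-- `Λ^{≥ m} W`: combinations of products of at least `m` generators. -/
def lengthAtLeast (deg : ι → ℕ) (m : ℕ) : Submodule ℚ (FreeGCA deg) :=
  monomialSpan deg fun l => m ≤ l.length

/-- `ΛU` as a subspace of `ΛW`, where `U` is spanned by the generators with index in `S`. -/
def subalgebraOn (deg : ι → ℕ) (S : Set ι) : Submodule ℚ (FreeGCA deg) :=
  monomialSpan deg fun l => ∀ i ∈ l, i ∈ S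

/-- `Λ^m U` as a subspace of `ΛW`, where `U` is spanned by the generators with index in `S`. -/
def lengthPartOn (deg : ι → ℕ) (S : Set ι) (m : ℕ) : Submodule ℚ (FreeGCA deg) :=
  monomialSpan deg fun l => l.length = m ∧ ∀ i ∈ l, i ∈ S

/-- `d` is a differential on `ΛW`: a graded derivation of degree `+1` with `d ∘ d = 0`. -/
structure IsDifferential (deg : ι → ℕ) (d : FreeGCA deg →ₗ[ℚ] FreeGCA deg) : Prop where
  map_degree : ∀ (k : ℕ) (x : FreeGCA deg), x ∈ degreePart deg k → d x ∈ degreePart deg (k + 1)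
  leibniz : ∀ (k : ℕ) (x y : FreeGCA deg), x ∈ degreePart deg k →
    d (x * y) = d x * y + (-1 : ℚ) ^ k • (x * d y)
  sq_zero : ∀ x : FreeGCA deg, d (d x) = 0

/-- The (total) cohomology `ker d / im d`. -/
abbrev Cohomology {deg : ι → ℕ} (d : FreeGCA deg →ₗ[ℚ] FreeGCA deg) : Type _ :=
  LinearMap.ker d ⧸ (LinearMap.range d).submoduleOf (LinearMap.ker d)

/-- An isomorphism of differential graded algebras `(ΛW, d) ≅ (ΛW', d')`: an isomorphism of
algebras that preserves degrees and commutes with the differentials. -/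
def DGAIsomorphic {deg : ι → ℕ} {deg' : κ → ℕ} (d : FreeGCA deg →ₗ[ℚ] FreeGCA deg)
    (d' : FreeGCA deg' →ₗ[ℚ] FreeGCA deg') : Prop :=
  ∃ f : FreeGCA deg ≃ₐ[ℚ] FreeGCA deg',
    (∀ (k : ℕ) (x : FreeGCA deg), x ∈ degreePart deg k → f x ∈ degreePart deg' k) ∧
      ∀ x : FreeGCA deg, f (d x) = d' (f x)

/-! ### Koszul-Sullivan extensions

For `W₁` and `W₂` with bases `ι` and `κ`, the algebra `ΛW₁ ⊗ ΛW₂ = Λ(W₁ ⊕ W₂)` is the free graded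
commutative algebra on `ι ⊕ κ`. -/

theorem base_comm (deg₁ : ι → ℕ) (deg₂ : κ → ℕ) (i j : ι) :
    gen (Sum.elim deg₁ deg₂) (Sum.inl i) * gen (Sum.elim deg₁ deg₂) (Sum.inl j) =
      (-1 : ℚ) ^ (deg₁ i * deg₁ j) •
        (gen (Sum.elim deg₁ deg₂) (Sum.inl j) * gen (Sum.elim deg₁ deg₂) (Sum.inl i)) :=
  gen_mul_gen (Sum.elim deg₁ deg₂) (Sum.inl i) (Sum.inl j)

/-- The inclusion `ΛW₁ → ΛW₁ ⊗ ΛW₂` of the base. -/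
def baseInclusion (deg₁ : ι → ℕ) (deg₂ : κ → ℕ) :
    FreeGCA deg₁ →ₐ[ℚ] FreeGCA (Sum.elim deg₁ deg₂) :=
  lift deg₁ (fun i => gen (Sum.elim deg₁ deg₂) (Sum.inl i)) (base_comm deg₁ deg₂)

@[simp]
theorem baseInclusion_gen (deg₁ : ι → ℕ) (deg₂ : κ → ℕ) (i : ι) :
    baseInclusion deg₁ deg₂ (gen deg₁ i) = gen (Sum.elim deg₁ deg₂) (Sum.inl i) :=
  lift_gen deg₁ _ _ i

theorem fibre_comm (deg₁ : ι → ℕ) (deg₂ : κ → ℕ) (i j : ι ⊕ κ) :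
    (Sum.elim (fun _ => 0) (gen deg₂) i : FreeGCA deg₂) * Sum.elim (fun _ => 0) (gen deg₂) j =
      (-1 : ℚ) ^ (Sum.elim deg₁ deg₂ i * Sum.elim deg₁ deg₂ j) •
        (Sum.elim (fun _ => 0) (gen deg₂) j * Sum.elim (fun _ => 0) (gen deg₂) i) := by
  rcases i with i | i <;> rcases j with j | j <;> simp
  exact gen_mul_gen deg₂ i j

/-- The projection `ΛW₁ ⊗ ΛW₂ → ΛW₂` to the fibre, which kills `W₁`. -/
def fibreProjection (deg₁ : ι → ℕ) (deg₂ : κ → ℕ) :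
    FreeGCA (Sum.elim deg₁ deg₂) →ₐ[ℚ] FreeGCA deg₂ :=
  lift (Sum.elim deg₁ deg₂) (Sum.elim (fun _ => 0) (gen deg₂)) (fibre_comm deg₁ deg₂)

@[simp]
theorem fibreProjection_gen_inl (deg₁ : ι → ℕ) (deg₂ : κ → ℕ) (i : ι) :
    fibreProjection deg₁ deg₂ (gen (Sum.elim deg₁ deg₂) (Sum.inl i)) = 0 :=
  lift_gen (Sum.elim deg₁ deg₂) _ _ (Sum.inl i)

@[simp]
theorem fibreProjection_gen_inr (deg₁ : ι → ℕ) (deg₂ : κ → ℕ) (j : κ) :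
    fibreProjection deg₁ deg₂ (gen (Sum.elim deg₁ deg₂) (Sum.inr j)) = gen deg₂ j :=
  lift_gen (Sum.elim deg₁ deg₂) _ _ (Sum.inr j)

/-- `(ΛW₁, d₁) → (ΛW₁ ⊗ ΛW₂, D) → (ΛW₂, d₂)` is a Koszul-Sullivan extension. -/
structure IsKSExtension {deg₁ : ι → ℕ} {deg₂ : κ → ℕ} (d₁ : FreeGCA deg₁ →ₗ[ℚ] FreeGCA deg₁)
    (d₂ : FreeGCA deg₂ →ₗ[ℚ] FreeGCA deg₂)
    (D : FreeGCA (Sum.elim deg₁ deg₂) →ₗ[ℚ] FreeGCA (Sum.elim deg₁ deg₂)) : Prop where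
  isDifferential : IsDifferential (Sum.elim deg₁ deg₂) D
  /-- `D` restricts to `d₁` on the base. -/
  base : ∀ x : FreeGCA deg₁, D (baseInclusion deg₁ deg₂ x) = baseInclusion deg₁ deg₂ (d₁ x)
  /-- `D` induces `d₂` on the fibre. -/
  fibre : ∀ x : FreeGCA (Sum.elim deg₁ deg₂),
    fibreProjection deg₁ deg₂ (D x) = d₂ (fibreProjection deg₁ deg₂ x)
  /-- `W₂` has an ordered homogeneous basis `w₁, w₂, …, w_m` such that
  `D wᵢ ∈ ΛW₁ ⊗ Λ(w₁, …, wᵢ₋₁)`. -/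
  nilpotent : ∃ (m : ℕ) (w : Fin m → FreeGCA (Sum.elim deg₁ deg₂)),
    LinearIndependent ℚ w ∧
    Submodule.span ℚ (Set.range w) =
      Submodule.span ℚ (Set.range fun j : κ => gen (Sum.elim deg₁ deg₂) (Sum.inr j)) ∧
    (∀ i, ∃ k, w i ∈ degreePart (Sum.elim deg₁ deg₂) k) ∧
    ∀ i, D (w i) ∈ Algebra.adjoin ℚ
      ((Set.range fun a : ι => gen (Sum.elim deg₁ deg₂) (Sum.inl a)) ∪ w '' {j | j < i})

/-- The rational toral rank of `(ΛW, d)`: the largest `n` for which there is a Koszul-Sullivan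
extension `(ΛAₙ, 0) → (ΛAₙ ⊗ ΛW, D) → (ΛW, d)`, with `Aₙ` spanned by `n` generators of degree `2`,
whose total space has finite-dimensional cohomology. It is a supremum in `ℕ∞`. -/
def rationalToralRank {deg : ι → ℕ} (d : FreeGCA deg →ₗ[ℚ] FreeGCA deg) : ℕ∞ :=
  sSup {N : ℕ∞ | ∃ n : ℕ, N = n ∧
    ∃ D : FreeGCA (Sum.elim (fun _ : Fin n => 2) deg) →ₗ[ℚ]
        FreeGCA (Sum.elim (fun _ : Fin n => 2) deg),
      IsKSExtension (0 : FreeGCA (fun _ : Fin n => 2) →ₗ[ℚ] FreeGCA (fun _ : Fin n => 2)) d D ∧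
        Module.Finite ℚ (Cohomology D)}

end FreeGCA

/-- A two-stage minimal model `(Λ(U, V), d)`, with finite-dimensional `U` and `V` concentrated in
positive degrees and given by homogeneous bases: `dU = 0`, `dV ⊆ ΛU`, and the differential has no
linear term. (The nilpotence condition of a minimal model is automatic: list the basis of `U`
first.) -/
structure TwoStageMinimalModel where
  /-- `dim U` -/
  dimU : ℕ
  /-- `dim V` -/
  dimV : ℕ
  /-- the degrees of the basis of `U` -/
  degU : Fin dimU → ℕ
  /-- the degrees of the basis of `V` -/
  degV : Fin dimV → ℕ
  degU_pos : ∀ i, 0 < degU i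
  degV_pos : ∀ j, 0 < degV j
  /-- the differential -/
  d : FreeGCA (Sum.elim degU degV) →ₗ[ℚ] FreeGCA (Sum.elim degU degV)
  isDifferential : FreeGCA.IsDifferential (Sum.elim degU degV) d
  d_U : ∀ i : Fin dimU, d (FreeGCA.gen (Sum.elim degU degV) (Sum.inl i)) = 0
  d_V : ∀ j : Fin dimV, d (FreeGCA.gen (Sum.elim degU degV) (Sum.inr j)) ∈
    FreeGCA.subalgebraOn (Sum.elim degU degV) (Set.range Sum.inl)
  minimal : ∀ j : Fin dimV, d (FreeGCA.gen (Sum.elim degU degV) (Sum.inr j)) ∈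
    FreeGCA.lengthAtLeast (Sum.elim degU degV) 2

namespace TwoStageMinimalModel

variable (M : TwoStageMinimalModel)

/-- Elliptic: the cohomology is finite-dimensional (as is the space of generators). -/
def IsElliptic : Prop := Module.Finite ℚ (FreeGCA.Cohomology M.d)

/-- The differential is quadratic: `dV ⊆ Λ²U`. -/
def IsQuadratic : Prop :=
  ∀ j : Fin M.dimV, M.d (FreeGCA.gen (Sum.elim M.degU M.degV) (Sum.inr j)) ∈
    FreeGCA.lengthPartOn (Sum.elim M.degU M.degV) (Set.range Sum.inl) 2

/-- `V` has maximal dimension: every isomorphic two-stage minimal model `Λ(U', V')` has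
`dim V' ≤ dim V`. -/
def HasMaximalV : Prop :=
  ∀ M' : TwoStageMinimalModel, FreeGCA.DGAIsomorphic M'.d M.d → M'.dimV ≤ M.dimV

/-- `dim U^even` -/
def dimUEven : ℕ := (Finset.univ.filter fun i : Fin M.dimU => Even (M.degU i)).card

/-- `U^odd` is `n`-connected: `(U^odd)^k = 0` for `k ≤ n`. -/
def UOddConnected (n : ℤ) : Prop := ∀ i, Odd (M.degU i) → ¬ (M.degU i : ℤ) ≤ n

/-- `U^even` is `n`-connected: `(U^even)^k = 0` for `k ≤ n`. -/
def UEvenConnected (n : ℤ) : Prop := ∀ i, Even (M.degU i) → ¬ (M.degU i : ℤ) ≤ n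

/-- `U^odd` is `n`-co-connected: `(U^odd)^k = 0` for `k ≥ n`. -/
def UOddCoconnected (n : ℤ) : Prop := ∀ i, Odd (M.degU i) → ¬ n ≤ (M.degU i : ℤ)

/-- `U^even` is `n`-co-connected: `(U^even)^k = 0` for `k ≥ n`. -/
def UEvenCoconnected (n : ℤ) : Prop := ∀ i, Even (M.degU i) → ¬ n ≤ (M.degU i : ℤ)

end TwoStageMinimalModel

end

/-!
Let `ΛAₙ ⊗ Λ(U, V)` be the total space of an extension with finite-dimensional cohomology, and let
`P` be the polynomial algebra on the even generators, `m` its ideal of polynomials without constant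
term. Killing the odd generators maps the image of `D` into an ideal `J ⊆ m` of `P`, generated by
the even parts of the differentials of the odd generators. The inequality follows from counting
generators: if the origin is an isolated zero of `dim V` polynomials in `n + dim U^even` variables,
then Krull's height theorem gives `n + dim U^even ≤ dim V`
(`MvPolynomial.card_le_card_of_isolated`).

* `V` has odd degrees (`IsElliptic.odd_degV`). For `y` in `V` of even degree, `dy = ∑ xᵢ uᵢ` with
  `xᵢ` even and `uᵢ` odd in `U`. After passing to the iterated mapping cone of the `xᵢ`, whose
  cohomology is still finite-dimensional, `y` can be corrected to a cocycle. Hence a polynomial in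
  `y` lies in `im d + (xᵢ)`, which is impossible as `dV ⊆ Λ²U`
  (`exists_aeval_mem_of_commutator`).
* The origin is an isolated zero of `J`: the powers of a base generator are cocycles, so a
  polynomial in it is a coboundary and lies in `J`; modulo the base generators the same holds for
  the even generators of `U`, by ellipticity of the fibre.
* The generators of `J` that come from odd generators of `U` are superfluous near the origin. Write
  `dv = ∑ cᵢₖ uᵢ uₖ` for `v` in `V`. Up to terms in `m J`, the part of `D² v = 0` that is linear in
  `uₖ` is the relation `∑ᵢ (cᵢₖ - cₖᵢ) Duᵢ = 0` between even parts (`sum_smul_evenProj_mem`);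
  either condition on the degrees of `U` makes all other contributions vanish. If `V` has maximal
  dimension, the coefficient vectors of these relations span the odd part of `U`
  (`HasMaximalV.single_mem_span`), as otherwise a generator could be moved from `U` to `V`
  (`HasMaximalV.false_of_functional`). So the even parts of `DU^odd` lie in `m J`, and Nakayama's
  lemma shows that near the origin the zero set of `J` is that of the `dim V` even parts of `DV`
  (`evenIdeal_le_of_isPrime`).
-/

/-! ### Isolated zeros of systems of polynomials -/

open MvPolynomial in
/-- The ideal of the origin of affine space has at least the expected height: the ideals of the
coordinate subspaces form a chain of primes. -/
theorem MvPolynomial.card_le_height_ker_constantCoeff (σ : Type*) [Fintype σ] :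
    (Fintype.card σ : ℕ∞) ≤
      (RingHom.ker (constantCoeff : MvPolynomial σ ℚ →+* ℚ)).height := by
  classical
  let f : Finset σ → MvPolynomial σ ℚ →ₐ[ℚ] MvPolynomial σ ℚ :=
    fun S => aeval fun i => if i ∈ S then 0 else X i
  have hprime (S : Finset σ) : (RingHom.ker (f S)).IsPrime := RingHom.ker_isPrime _
  have key : ∀ S : Finset σ, (S.card : ℕ∞) ≤ (RingHom.ker (f S)).height := by
    intro S
    induction S using Finset.induction_on with
    | empty => simp
    | insert i S hi ih =>
      have hcomp : f (insert i S) = (f {i}).comp (f S) := by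
        ext j
        by_cases hj : j = i
        · subst hj; simp [f, hi]
        · by_cases hS : j ∈ S <;> simp [f, hj, hS]
      have hlt : RingHom.ker (f S) < RingHom.ker (f (insert i S)) := by
        refine lt_of_le_of_ne (fun x hx => ?_) fun h => ?_
        · rw [RingHom.mem_ker] at hx ⊢
          rw [hcomp, AlgHom.comp_apply, hx, map_zero]
        · have h1 : (X i : MvPolynomial σ ℚ) ∈ RingHom.ker (f (insert i S)) := by
            simp [f]
          rw [← h] at h1
          simp [f, hi] at h1
      rw [Finset.card_insert_of_notMem hi]
      push_cast
      have := hprime S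
      have := hprime (insert i S)
      exact (add_le_add_left ih 1).trans (Ideal.height_add_one_le_of_lt_of_isPrime hlt)
  have h := key Finset.univ
  have heq : RingHom.ker (f Finset.univ) =
      RingHom.ker (constantCoeff : MvPolynomial σ ℚ →+* ℚ) := by
    have : f Finset.univ = (Algebra.ofId ℚ _).comp (aeval fun _ => 0) := by ext; simp [f]
    ext x
    rw [RingHom.mem_ker, RingHom.mem_ker, this]
    simp [Algebra.ofId_apply]
  rwa [heq] at h

/-- A form of Krull's height theorem: if the origin is an isolated point of the zero set of
finitely many polynomials without constant term, there are at least as many polynomials as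
variables. -/
theorem MvPolynomial.card_le_card_of_isolated {σ β : Type*} [Fintype σ] [Fintype β]
    (g : β → MvPolynomial σ ℚ) (hg : ∀ b, constantCoeff (g b) = 0)
    (h : ∀ q : Ideal (MvPolynomial σ ℚ), q.IsPrime → q ≤ RingHom.ker constantCoeff →
      (∀ b, g b ∈ q) → ∀ i, X i ∈ q) :
    Fintype.card σ ≤ Fintype.card β := by
  classical
  have hm : RingHom.ker (constantCoeff : MvPolynomial σ ℚ →+* ℚ) ∈
      (Ideal.span ((Finset.univ.image g : Finset _) : Set (MvPolynomial σ ℚ))).minimalPrimes := by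
    refine ⟨⟨RingHom.ker_isPrime _, ?_⟩, ?_⟩
    · rw [Ideal.span_le]
      intro x hx
      simp only [Finset.coe_image, Finset.coe_univ, Set.image_univ, Set.mem_range] at hx
      obtain ⟨b, rfl⟩ := hx
      exact hg b
    · rintro q ⟨hq, hle⟩ hqm
      have hX := h q hq hqm fun b => hle (Ideal.subset_span (by simp))
      intro x hx
      have hx' : x ∈ Ideal.span (X '' (Set.univ : Set σ)) := by
        rw [mem_ideal_span_X_image]
        intro e he
        by_contra! hcon
        have : e = 0 := by ext i; simpa using hcon i
        subst this
        exact (mem_support_iff.mp he) hx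
      exact Ideal.span_le.mpr (by rintro _ ⟨i, -, rfl⟩; exact hX i) hx'
  have := hm.1.1
  have h1 := Ideal.height_le_card_of_mem_minimalPrimes_span_finset hm
  have h2 := (card_le_height_ker_constantCoeff σ).trans h1
  have h3 : (Finset.univ.image g).card ≤ Fintype.card β := Finset.card_image_le
  have h4 : Fintype.card σ ≤ (Finset.univ.image g).card := by exact_mod_cast h2
  exact h4.trans h3

/-- Let `q` be a prime ideal of polynomials without constant term. A polynomial `x` without constant
term that is algebraic over `ℚ` modulo `q` lies in `q`: a relation has the form
`x ^ k * r(x) ∈ q` with `r(0) ≠ 0`. -/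
theorem MvPolynomial.mem_of_aeval_mem {σ : Type*} {q : Ideal (MvPolynomial σ ℚ)} (hq : q.IsPrime)
    (hqm : q ≤ RingHom.ker constantCoeff) {x : MvPolynomial σ ℚ} (hx : constantCoeff x = 0)
    {p : Polynomial ℚ} (hp : p ≠ 0) (h : Polynomial.aeval x p ∈ q) : x ∈ q := by
  obtain ⟨r, hr, hdvd⟩ := Polynomial.exists_eq_pow_rootMultiplicity_mul_and_not_dvd p hp 0
  rw [hr, map_mul, map_pow] at h
  rcases hq.mem_or_mem h with h1 | h1
  · simpa using hq.mem_of_pow_mem _ h1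
  · exfalso
    have h2 : constantCoeff (Polynomial.aeval x r) = 0 := hqm h1
    apply hdvd
    simp only [map_zero, sub_zero, Polynomial.X_dvd_iff]
    have h3 : constantCoeff (Polynomial.aeval x r) = r.coeff 0 := by
      rw [Polynomial.aeval_def, Polynomial.hom_eval₂, hx, Polynomial.eval₂_at_zero]
      simp
    rw [← h3, h2]

/-! ### Mapping cones -/

/-- The cohomology of `(E, D)`, embedded into `E / im D`. -/
def cocycleClasses {E : Type*} [AddCommGroup E] [Module ℚ E] (D : Module.End ℚ E) :
    Submodule ℚ (E ⧸ LinearMap.range D) :=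
  (LinearMap.ker D).map (LinearMap.range D).mkQ

theorem cocycleClasses_fg {E : Type*} [AddCommGroup E] [Module ℚ E] (D : Module.End ℚ E)
    (h : Module.Finite ℚ (LinearMap.ker D ⧸ (LinearMap.range D).submoduleOf (LinearMap.ker D))) :
    (cocycleClasses D).FG := by
  let f := Submodule.mapQ ((LinearMap.range D).submoduleOf (LinearMap.ker D)) (LinearMap.range D)
    (LinearMap.ker D).subtype le_rfl
  have hf : cocycleClasses D = (⊤ : Submodule ℚ _).map f := by
    ext x
    constructor
    · rintro ⟨a, ha, rfl⟩
      exact ⟨Submodule.Quotient.mk ⟨a, ha⟩, trivial, rfl⟩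
    · rintro ⟨y, -, rfl⟩
      obtain ⟨a, rfl⟩ := Submodule.Quotient.mk_surjective _ y
      exact ⟨a, a.2, rfl⟩
  rw [hf]
  exact (Module.finite_def.mp h).map f

/-- The differential of the mapping cone of the endomorphism `X` of `(E, D)`. -/
def coneDifferential {E : Type*} [AddCommGroup E] [Module ℚ E] (D X : Module.End ℚ E) :
    Module.End ℚ (E × E) :=
  (D.coprod X).prod (-(D ∘ₗ LinearMap.snd ℚ E E))

@[simp]
theorem coneDifferential_apply {E : Type*} [AddCommGroup E] [Module ℚ E] (D X : Module.End ℚ E)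
    (a b : E) : coneDifferential D X (a, b) = (D a + X b, -D b) := by
  simp [coneDifferential]

/-- The cone of a chain map of a complex with finite-dimensional cohomology to itself has
finite-dimensional cohomology. -/
theorem cocycleClasses_coneDifferential_fg {E : Type*} [AddCommGroup E] [Module ℚ E]
    (D X : Module.End ℚ E) (h : (cocycleClasses D).FG) (hX : ∀ a, D (X a) = X (D a)) :
    (cocycleClasses (coneDifferential D X)).FG := by
  have hle : LinearMap.range (coneDifferential D X) ≤
      (LinearMap.range D).comap (LinearMap.snd ℚ E E) := by
    rintro _ ⟨⟨a, b⟩, rfl⟩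
    exact ⟨-b, by simp⟩
  have hle' : LinearMap.range D ≤
      (LinearMap.range (coneDifferential D X)).comap (LinearMap.inl ℚ E E) := by
    rintro _ ⟨a, rfl⟩
    exact ⟨(a, 0), by simp⟩
  have hnoeth {s : Submodule ℚ (E ⧸ LinearMap.range D)} (hs : s ≤ cocycleClasses D) : s.FG := by
    have : Module.Finite ℚ (cocycleClasses D) := Module.Finite.iff_fg.mpr h
    exact Module.Finite.iff_fg.mp (Submodule.finiteDimensional_of_le hs)
  -- the long exact sequence of the cone: kernel and image of `H(cone) → H(E)` are finite
  refine Submodule.fg_of_fg_map_of_fg_inf_ker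
    (Submodule.mapQ _ _ (LinearMap.snd ℚ E E) hle) (hnoeth ?_) ?_
  · rintro _ ⟨_, ⟨⟨a, b⟩, hab, rfl⟩, rfl⟩
    refine ⟨b, ?_, by simp⟩
    have hab' : coneDifferential D X (a, b) = 0 := hab
    simp only [coneDifferential_apply, Prod.mk_eq_zero, neg_eq_zero] at hab'
    exact hab'.2
  · have hsub : cocycleClasses (coneDifferential D X) ⊓
        LinearMap.ker (Submodule.mapQ _ _ (LinearMap.snd ℚ E E) hle) ≤
        (cocycleClasses D).map (Submodule.mapQ _ _ (LinearMap.inl ℚ E E) hle') := by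
      rintro _ ⟨⟨⟨a, b⟩, hab, rfl⟩, hker⟩
      have hb : b ∈ LinearMap.range D := by
        simpa [LinearMap.mem_ker, Submodule.Quotient.mk_eq_zero] using hker
      obtain ⟨c, rfl⟩ := hb
      have hab' : coneDifferential D X (a, D c) = 0 := hab
      simp only [coneDifferential_apply, Prod.mk_eq_zero, neg_eq_zero] at hab'
      refine ⟨Submodule.Quotient.mk (a + X c), ⟨a + X c, ?_, rfl⟩, ?_⟩
      · simp [hX, hab'.1]
      · simp only [Submodule.mapQ_apply, Submodule.mkQ_apply, LinearMap.coe_inl]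
        rw [Submodule.Quotient.eq]
        exact ⟨(0, c), by simp⟩
    have : Module.Finite ℚ
        ((cocycleClasses D).map (Submodule.mapQ _ _ (LinearMap.inl ℚ E E) hle')) :=
      Module.Finite.iff_fg.mpr (h.map _)
    exact Module.Finite.iff_fg.mp (Submodule.finiteDimensional_of_le hsub)

/-- If the cohomology of `(E, D)` is finite-dimensional, the orbit of a cocycle under an
endomorphism of the complex satisfies a polynomial relation modulo coboundaries. -/
theorem exists_aeval_mem_range {E : Type*} [AddCommGroup E] [Module ℚ E]
    (D Y : Module.End ℚ E) (h : (cocycleClasses D).FG) (e : E) (he : D e = 0)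
    (hY : ∀ a, D (Y a) = Y (D a)) :
    ∃ p : Polynomial ℚ, p ≠ 0 ∧ Polynomial.aeval Y p e ∈ LinearMap.range D := by
  by_contra! hcon
  let φ : Polynomial ℚ →ₗ[ℚ] E := (LinearMap.applyₗ e) ∘ₗ (Polynomial.aeval Y).toLinearMap
  have hφ (p : Polynomial ℚ) : φ p = Polynomial.aeval Y p e := rfl
  have hcomm : Commute D Y := LinearMap.ext hY
  have hker (p : Polynomial ℚ) : D (φ p) = 0 := by
    have h1 : Commute D (Polynomial.aeval Y p) := by
      induction p using Polynomial.induction_on' with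
      | add p q hp hq => rw [map_add]; exact hp.add_right hq
      | monomial n c =>
        rw [Polynomial.aeval_monomial]
        have hc : Commute D (algebraMap ℚ (Module.End ℚ E) c) := (Algebra.commutes c D).symm
        exact hc.mul_right (hcomm.pow_right n)
    have h2 : D (Polynomial.aeval Y p e) = Polynomial.aeval Y p (D e) := LinearMap.congr_fun h1 e
    rw [hφ, h2, he, map_zero]
  let ψ : Polynomial ℚ →ₗ[ℚ] cocycleClasses D :=
    ((LinearMap.range D).mkQ ∘ₗ φ).codRestrict _ fun p => ⟨φ p, hker p, rfl⟩
  have hinj : Function.Injective ψ := by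
    rw [injective_iff_map_eq_zero]
    intro p hp
    by_contra hne
    apply hcon p hne
    have h3 : (LinearMap.range D).mkQ (φ p) = 0 := congrArg Subtype.val hp
    simpa [hφ] using h3
  have : Module.Finite ℚ (cocycleClasses D) := Module.Finite.iff_fg.mpr h
  exact Polynomial.not_finite (R := ℚ) (Module.Finite.of_injective ψ hinj)

/-- Let `Y` be an endomorphism of a complex `(E, D)` with finite-dimensional cohomology whose
commutator with `D` is a sum of products `X U`, with chain maps `X` and anticommuting odd `U`.
Then the orbit of a cocycle under `Y` satisfies a polynomial relation modulo coboundaries and the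
images of the `X`: in the iterated mapping cone of the `X`, where the `X` become homotopic
to zero, `Y` can be corrected to a chain map. -/
theorem exists_aeval_mem_of_commutator {ι : Type*} (L : List ι) :
    ∀ {E : Type*} [AddCommGroup E] [Module ℚ E] (D Y : Module.End ℚ E)
    (X U : ι → Module.End ℚ E) (_ : (cocycleClasses D).FG) (e : E) (_ : D e = 0)
    (_ : ∀ i a, D (X i a) = X i (D a)) (_ : ∀ i a, D (U i a) = -U i (D a))
    (_ : ∀ i j a, X i (X j a) = X j (X i a)) (_ : ∀ i j a, X i (U j a) = U j (X i a))
    (_ : ∀ i a, X i (Y a) = Y (X i a)) (_ : ∀ i a, U i (Y a) = Y (U i a))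
    (_ : ∀ i j a, U i (U j a) = -U j (U i a))
    (_ : ∀ a, D (Y a) = Y (D a) + (L.map fun i => X i (U i a)).sum)
    (N : Submodule ℚ E) (_ : LinearMap.range D ≤ N) (_ : ∀ i, LinearMap.range (X i) ≤ N),
    ∃ p : Polynomial ℚ, p ≠ 0 ∧ Polynomial.aeval Y p e ∈ N := by
  induction L with
  | nil =>
    intro E _ _ D Y X U hfin e he _ _ _ _ _ _ _ hY N hN _
    obtain ⟨p, hp, h⟩ := exists_aeval_mem_range D Y hfin e he (by simpa using hY)
    exact ⟨p, hp, hN h⟩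
  | cons i₀ L ih =>
    intro E _ _ D Y X U hfin e he hDX hDU hXX hXU hXY hUY hUU hY N hN hXN
    -- in the cone of `X i₀`, the correction by `U i₀` removes one term of the commutator
    obtain ⟨p, hp, h⟩ := ih (coneDifferential D (X i₀))
      ((Y ∘ₗ LinearMap.fst ℚ E E).prod (Y ∘ₗ LinearMap.snd ℚ E E - U i₀ ∘ₗ LinearMap.fst ℚ E E))
      (fun i => (X i).prodMap (X i)) (fun i => (U i).prodMap (-U i))
      (cocycleClasses_coneDifferential_fg D _ hfin (hDX i₀)) (e, 0) (by simp [he])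
      (by rintro i ⟨a, b⟩; simp [hDX, hXX i₀ i])
      (by rintro i ⟨a, b⟩; simp [hDU, hXU i₀ i]; abel)
      (by rintro i j ⟨a, b⟩; simp [hXX i j])
      (by rintro i j ⟨a, b⟩; simp [hXU i j])
      (by rintro i ⟨a, b⟩; simp [hXY i, hXU i])
      (by rintro i ⟨a, b⟩; simp [hUY i, hUU i i₀]; abel)
      (by rintro i j ⟨a, b⟩; simp [hUU i j])
      (by
        rintro ⟨a, b⟩
        have hsum : (L.map fun i => ((X i).prodMap (X i)) (((U i).prodMap (-U i)) (a, b))).sum =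
            ((L.map fun i => X i (U i a)).sum, -(L.map fun i => X i (U i b)).sum) := by
          clear hY ih
          induction L with
          | nil => ext <;> simp
          | cons j L ihL =>
            simp only [List.map_cons, List.sum_cons, ihL]
            simp [add_comm]
        rw [hsum]
        simp [hY, hDU, hXY, hXU]
        constructor <;> abel)
      (N.comap (LinearMap.fst ℚ E E))
      (by
        rintro _ ⟨⟨a, b⟩, rfl⟩
        simpa using N.add_mem (hN ⟨a, rfl⟩) (hXN i₀ ⟨b, rfl⟩))
      (by
        rintro i _ ⟨⟨a, b⟩, rfl⟩
        exact hXN i ⟨a, rfl⟩)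
    refine ⟨p, hp, ?_⟩
    have hfst : ∀ (q : Polynomial ℚ) (z : E × E), (Polynomial.aeval ((Y ∘ₗ LinearMap.fst ℚ E E).prod
        (Y ∘ₗ LinearMap.snd ℚ E E - U i₀ ∘ₗ LinearMap.fst ℚ E E) : Module.End ℚ (E × E)) q z).1 =
        Polynomial.aeval Y q z.1 := by
      intro q
      induction q using Polynomial.induction_on' with
      | add p q hp hq => intro z; simp [hp, hq]
      | monomial n c =>
        intro z
        simp only [Polynomial.aeval_monomial, Module.End.mul_apply,
          Module.algebraMap_end_apply, Prod.smul_fst]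
        congr 1
        induction n generalizing z with
        | zero => simp
        | succ n ihn =>
          rw [pow_succ, pow_succ, Module.End.mul_apply, Module.End.mul_apply, ihn]
          rfl
    have h' := Submodule.mem_comap.mp h
    rwa [LinearMap.fst_apply, hfst] at h'

/-! ### Monomials in free graded commutative algebras -/

namespace FreeGCA

variable {ι : Type*} {deg : ι → ℕ}

theorem list_prod_mem_monomialSpan {P : List ι → Prop} {l : List ι} (hl : P l) :
    (l.map (gen deg)).prod ∈ monomialSpan deg P :=
  Submodule.subset_span ⟨l, hl, rfl⟩

theorem list_prod_mem_degreePart (l : List ι) :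
    (l.map (gen deg)).prod ∈ degreePart deg (l.map deg).sum :=
  list_prod_mem_monomialSpan (P := fun l' => (l'.map deg).sum = _) rfl

theorem gen_mem_degreePart (i : ι) : gen deg i ∈ degreePart deg (deg i) := by
  simpa using list_prod_mem_degreePart (deg := deg) [i]

theorem one_mem_degreePart : (1 : FreeGCA deg) ∈ degreePart deg 0 := by
  simpa using list_prod_mem_degreePart (deg := deg) []

theorem mul_mem_degreePart {k l : ℕ} {x y : FreeGCA deg} (hx : x ∈ degreePart deg k)
    (hy : y ∈ degreePart deg l) : x * y ∈ degreePart deg (k + l) := by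
  have h : degreePart deg k * degreePart deg l ≤ degreePart deg (k + l) := by
    rw [degreePart, degreePart, monomialSpan, monomialSpan, Submodule.span_mul_span,
      Submodule.span_le]
    rintro _ ⟨_, ⟨l₁, h₁, rfl⟩, _, ⟨l₂, h₂, rfl⟩, rfl⟩
    have := list_prod_mem_degreePart (deg := deg) (l₁ ++ l₂)
    simpa [h₁, h₂] using this
  exact h (Submodule.mul_mem_mul hx hy)

theorem monomialSpan_true : monomialSpan deg (fun _ => True) = ⊤ := by
  rw [eq_top_iff]
  rintro x -
  obtain ⟨a, ha⟩ := RingQuot.mkAlgHom_surjective ℚ (Rel deg) x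
  change mk deg a = x at ha
  subst ha
  have hmul {x y : FreeGCA deg} (hx : x ∈ monomialSpan deg (fun _ => True))
      (hy : y ∈ monomialSpan deg (fun _ => True)) :
      x * y ∈ monomialSpan deg (fun _ => True) := by
    have h : monomialSpan deg (fun _ => True) * monomialSpan deg (fun _ => True) ≤
        monomialSpan deg (fun _ => True) := by
      rw [monomialSpan, Submodule.span_mul_span, Submodule.span_le]
      rintro _ ⟨_, ⟨l₁, -, rfl⟩, _, ⟨l₂, -, rfl⟩, rfl⟩
      exact Submodule.subset_span ⟨l₁ ++ l₂, trivial, by simp⟩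
    exact h (Submodule.mul_mem_mul hx hy)
  have hone : (1 : FreeGCA deg) ∈ monomialSpan deg (fun _ => True) :=
    list_prod_mem_monomialSpan (l := []) trivial
  induction a using FreeAlgebra.induction with
  | grade0 r =>
    rw [AlgHom.commutes, Algebra.algebraMap_eq_smul_one]
    exact Submodule.smul_mem _ _ hone
  | grade1 i =>
    have := list_prod_mem_monomialSpan (deg := deg) (P := fun _ => True) (l := [i]) trivial
    simpa [gen] using this
  | mul a b ha hb => rw [map_mul]; exact hmul ha hb
  | add a b ha hb => rw [map_add]; exact Submodule.add_mem _ ha hb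

theorem map_mem_of_list_prod {B : Type*} [AddCommGroup B] [Module ℚ B] (f : FreeGCA deg →ₗ[ℚ] B)
    (N : Submodule ℚ B) {P : List ι → Prop} (h : ∀ l : List ι, P l → f (l.map (gen deg)).prod ∈ N)
    {x : FreeGCA deg} (hx : x ∈ monomialSpan deg P) : f x ∈ N := by
  have : monomialSpan deg P ≤ N.comap f := by
    rw [monomialSpan, Submodule.span_le]
    rintro _ ⟨l, hl, rfl⟩
    exact h l hl
  exact this hx

theorem linearMap_mem_of_list_prod {B : Type*} [AddCommGroup B] [Module ℚ B]
    (f : FreeGCA deg →ₗ[ℚ] B) (N : Submodule ℚ B) (h : ∀ l : List ι, f (l.map (gen deg)).prod ∈ N)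
    (x : FreeGCA deg) : f x ∈ N :=
  map_mem_of_list_prod f N (P := fun _ => True) (fun l _ => h l)
    (by rw [monomialSpan_true]; trivial)

theorem algHom_ext {B : Type*} [Ring B] [Algebra ℚ B] {f g : FreeGCA deg →ₐ[ℚ] B}
    (h : ∀ i, f (gen deg i) = g (gen deg i)) : f = g := by
  ext x
  have := linearMap_mem_of_list_prod (f.toLinearMap - g.toLinearMap) ⊥ (fun l => by
    have : (fun i => f (gen deg i)) = fun i => g (gen deg i) := funext h
    simp [map_list_prod, Function.comp_def, this]) x
  simpa [sub_eq_zero] using this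

/-- Generators of even degree are central. -/
theorem gen_mul_comm_of_even {i : ι} (hi : Even (deg i)) (x : FreeGCA deg) :
    gen deg i * x = x * gen deg i := by
  have := linearMap_mem_of_list_prod
    (LinearMap.mulLeft ℚ (gen deg i) - LinearMap.mulRight ℚ (gen deg i)) ⊥ (fun l => by
      induction l with
      | nil => simp
      | cons j l ih =>
        simp only [LinearMap.sub_apply, LinearMap.mulLeft_apply, LinearMap.mulRight_apply,
          Submodule.mem_bot, sub_eq_zero, List.map_cons, List.prod_cons] at ih ⊢
        rw [← mul_assoc, gen_mul_gen, (hi.mul_right (deg j)).neg_one_pow, one_smul, mul_assoc, ih,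
          mul_assoc]) x
  simpa [sub_eq_zero] using this

theorem gen_mul_gen_of_odd {i j : ι} (hi : Odd (deg i)) (hj : Odd (deg j)) :
    gen deg i * gen deg j = -(gen deg j * gen deg i) := by
  rw [gen_mul_gen, (hi.mul hj).neg_one_pow, neg_one_smul]

/-- A homomorphism from `ΛW` to a commutative algebra is given by the images of the generators,
as soon as the images of generators of odd degree have zero products. -/
noncomputable def liftComm (deg : ι → ℕ) {B : Type*} [CommRing B] [Algebra ℚ B] (f : ι → B)
    (hf : ∀ i j, Odd (deg i) → Odd (deg j) → f i * f j = 0) : FreeGCA deg →ₐ[ℚ] B :=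
  lift deg f fun i j => by
    by_cases h : Odd (deg i) ∧ Odd (deg j)
    · rw [hf i j h.1 h.2, hf j i h.2 h.1, smul_zero]
    · have : Even (deg i * deg j) := by
        rw [Nat.even_mul, ← Nat.not_odd_iff_even, ← Nat.not_odd_iff_even]
        tauto
      rw [this.neg_one_pow, one_smul, mul_comm]

@[simp]
theorem liftComm_gen {B : Type*} [CommRing B] [Algebra ℚ B] (f : ι → B)
    (hf : ∀ i j, Odd (deg i) → Odd (deg j) → f i * f j = 0) (i : ι) :
    liftComm deg f hf (gen deg i) = f i :=
  lift_gen deg f _ i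

/-! ### Differentials on monomials -/

namespace IsDifferential

variable {d : FreeGCA deg →ₗ[ℚ] FreeGCA deg}

theorem map_one (hd : IsDifferential deg d) : d 1 = 0 := by
  simpa using hd.leibniz 0 1 1 one_mem_degreePart

theorem map_gen_mul (hd : IsDifferential deg d) (i : ι) (x : FreeGCA deg) :
    d (gen deg i * x) = d (gen deg i) * x + (-1 : ℚ) ^ deg i • (gen deg i * d x) :=
  hd.leibniz _ _ _ (gen_mem_degreePart i)

theorem map_gen_mul_of_even (hd : IsDifferential deg d) {i : ι} (hi : Even (deg i))
    (x : FreeGCA deg) : d (gen deg i * x) = d (gen deg i) * x + gen deg i * d x := by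
  rw [hd.map_gen_mul, hi.neg_one_pow, one_smul]

theorem map_gen_mul_of_odd (hd : IsDifferential deg d) {i : ι} (hi : Odd (deg i))
    (x : FreeGCA deg) : d (gen deg i * x) = d (gen deg i) * x - gen deg i * d x := by
  rw [hd.map_gen_mul, hi.neg_one_pow, neg_one_smul, sub_eq_add_neg]

theorem map_gen_mem (hd : IsDifferential deg d) (i : ι) :
    d (gen deg i) ∈ degreePart deg (deg i + 1) :=
  hd.map_degree _ _ (gen_mem_degreePart i)

/-- A homomorphism to a commutative algebra maps all of `im d` into an ideal as soon as it does so
for the differentials of the generators. -/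
theorem algHom_mem (hd : IsDifferential deg d) {B : Type*} [CommRing B] [Algebra ℚ B]
    (f : FreeGCA deg →ₐ[ℚ] B) (J : Ideal B) (h : ∀ i, f (d (gen deg i)) ∈ J) (x : FreeGCA deg) :
    f (d x) ∈ J := by
  refine linearMap_mem_of_list_prod (f.toLinearMap ∘ₗ d) (J.restrictScalars ℚ) (fun l => ?_) x
  induction l with
  | nil => simp [hd.map_one]
  | cons i l ih =>
    simp only [List.map_cons, List.prod_cons, LinearMap.comp_apply, hd.map_gen_mul, map_add,
      map_smul]
    refine Submodule.add_mem _ ?_ (Submodule.smul_mem _ _ ?_)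
    · simpa using J.mul_mem_right _ (h i)
    · simpa using J.mul_mem_left _ ih

end IsDifferential

/-! ### The even quotient and first-order jets -/

/-- The polynomial algebra on the generators of even degree. -/
abbrev EvenPoly (deg : ι → ℕ) : Type _ := MvPolynomial {i : ι // Even (deg i)} ℚ

open Classical in
/-- The quotient map of `ΛW` that kills the generators of odd degree. -/
noncomputable def evenProj (deg : ι → ℕ) : FreeGCA deg →ₐ[ℚ] EvenPoly deg :=
  liftComm deg (fun i => if h : Even (deg i) then MvPolynomial.X ⟨i, h⟩ else 0) fun i j hi _ => by
    rw [dif_neg (Nat.not_even_iff_odd.mpr hi), zero_mul]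

theorem evenProj_gen_of_even {i : ι} (h : Even (deg i)) :
    evenProj deg (gen deg i) = MvPolynomial.X ⟨i, h⟩ := by
  rw [evenProj, liftComm_gen, dif_pos h]

theorem evenProj_gen_of_odd {i : ι} (h : Odd (deg i)) : evenProj deg (gen deg i) = 0 := by
  rw [evenProj, liftComm_gen, dif_neg (Nat.not_even_iff_odd.mpr h)]

theorem evenProj_list_prod_of_odd {l : List ι} (hl : Odd (l.map deg).sum) :
    evenProj deg (l.map (gen deg)).prod = 0 := by
  induction l with
  | nil => simp at hl
  | cons i l ih =>
    rw [List.map_cons, List.prod_cons, map_mul]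
    rcases Nat.even_or_odd (deg i) with hi | hi
    · rw [ih, mul_zero]
      rw [List.map_cons, List.sum_cons, Nat.odd_add'] at hl
      exact hl.mpr hi
    · rw [evenProj_gen_of_odd hi, zero_mul]

theorem evenProj_of_odd {k : ℕ} (hk : Odd k) {x : FreeGCA deg} (hx : x ∈ degreePart deg k) :
    evenProj deg x = 0 :=
  map_mem_of_list_prod (evenProj deg).toLinearMap ⊥
    (fun l (hl : (l.map deg).sum = k) => evenProj_list_prod_of_odd (hl ▸ hk)) hx

theorem constantCoeff_evenProj {k : ℕ} (hk : k ≠ 0) {x : FreeGCA deg} (hx : x ∈ degreePart deg k) :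
    MvPolynomial.constantCoeff (evenProj deg x) = 0 := by
  have hgen (i : ι) : MvPolynomial.constantCoeff (evenProj deg (gen deg i)) = 0 := by
    rcases Nat.even_or_odd (deg i) with hi | hi
    · rw [evenProj_gen_of_even hi, MvPolynomial.constantCoeff_X]
    · rw [evenProj_gen_of_odd hi, map_zero]
  refine map_mem_of_list_prod (MvPolynomial.lcoeff ℚ 0 ∘ₗ (evenProj deg).toLinearMap) ⊥
    (fun l hl => ?_) hx
  change MvPolynomial.constantCoeff (evenProj deg (l.map (gen deg)).prod) = 0
  cases l with
  | nil => exact absurd hl.symm hk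
  | cons i l => rw [List.map_cons, List.prod_cons, map_mul, map_mul, hgen, zero_mul]

open Classical in
/-- The homomorphism `ΛW → ℚ[even generators][ε]`, `ε² = 0`, that maps the odd generator `j` to
`ε` and kills the other odd generators. -/
noncomputable def oddJet (deg : ι → ℕ) (j : ι) :
    FreeGCA deg →ₐ[ℚ] DualNumber (EvenPoly deg) :=
  liftComm deg (fun i => if h : Even (deg i) then TrivSqZeroExt.inl (MvPolynomial.X ⟨i, h⟩) else
    if i = j then DualNumber.eps else 0) fun i k hi hk => by
    rw [dif_neg (Nat.not_even_iff_odd.mpr hi), dif_neg (Nat.not_even_iff_odd.mpr hk)]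
    split_ifs <;> simp

/-- The coefficient of the odd generator `j` in the part of an element that is linear in the odd
generators. -/
noncomputable def oddCoeff (deg : ι → ℕ) (j : ι) : FreeGCA deg →ₗ[ℚ] EvenPoly deg where
  toFun x := (oddJet deg j x).snd
  map_add' x y := by rw [map_add, TrivSqZeroExt.snd_add]
  map_smul' r x := by rw [map_smul, TrivSqZeroExt.snd_smul, RingHom.id_apply]

section oddCoeff

variable {j : ι}

theorem fst_oddJet (x : FreeGCA deg) : (oddJet deg j x).fst = evenProj deg x := by
  have h : (TrivSqZeroExt.fstHom ℚ (EvenPoly deg) (EvenPoly deg)).comp (oddJet deg j) =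
      evenProj deg := by
    refine algHom_ext fun i => ?_
    rcases Nat.even_or_odd (deg i) with hi | hi
    · simp [oddJet, hi, evenProj_gen_of_even hi]
    · rw [evenProj_gen_of_odd hi]
      have hi' := Nat.not_even_iff_odd.mpr hi
      by_cases hij : i = j
      · subst hij; simp [oddJet, hi']
      · simp [oddJet, hi', hij]
  exact DFunLike.congr_fun h x

/-- The coefficient of an odd generator is a derivation over `evenProj`, without signs. -/
theorem oddCoeff_mul (x y : FreeGCA deg) : oddCoeff deg j (x * y) =
    oddCoeff deg j x * evenProj deg y + evenProj deg x * oddCoeff deg j y := by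
  simp only [oddCoeff, LinearMap.coe_mk, AddHom.coe_mk, map_mul, TrivSqZeroExt.snd_mul,
    fst_oddJet]
  rw [smul_eq_mul, op_smul_eq_mul, add_comm]

theorem oddCoeff_one : oddCoeff deg j 1 = 0 := by simp [oddCoeff]

theorem oddCoeff_gen_of_even {i : ι} (hi : Even (deg i)) : oddCoeff deg j (gen deg i) = 0 := by
  simp [oddCoeff, oddJet, hi]

theorem oddCoeff_gen_self (hj : Odd (deg j)) : oddCoeff deg j (gen deg j) = 1 := by
  simp [oddCoeff, oddJet, Nat.not_even_iff_odd.mpr hj]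

theorem oddCoeff_gen_of_ne {i : ι} (hi : i ≠ j) : oddCoeff deg j (gen deg i) = 0 := by
  by_cases h : Even (deg i)
  · exact oddCoeff_gen_of_even h
  · simp [oddCoeff, oddJet, h, hi]

theorem oddCoeff_list_prod_of_notMem {l : List ι} (hl : j ∉ l) :
    oddCoeff deg j (l.map (gen deg)).prod = 0 := by
  induction l with
  | nil => exact oddCoeff_one
  | cons i l ih =>
    rw [List.mem_cons, not_or] at hl
    rw [List.map_cons, List.prod_cons, oddCoeff_mul, oddCoeff_gen_of_ne (Ne.symm hl.1), ih hl.2]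
    simp

/-- Modulo an ideal that contains the even part of `im d`, the coefficient of an odd generator in
`d z` for `z` of even degree is determined by the differentials of the even generators in `z`:
for parity reasons, odd generators contribute only multiples of even parts of `im d`. -/
theorem IsDifferential.oddCoeff_list_prod_mem {d : FreeGCA deg →ₗ[ℚ] FreeGCA deg}
    (hd : IsDifferential deg d) (J : Ideal (EvenPoly deg)) (hJ : ∀ x, evenProj deg (d x) ∈ J)
    {l : List ι} (hl : Even (l.map deg).sum)
    (h : ∀ i ∈ l, Even (deg i) → oddCoeff deg j (d (gen deg i)) ∈ J) :
    oddCoeff deg j (d (l.map (gen deg)).prod) ∈ J := by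
  induction l with
  | nil => simp [hd.map_one]
  | cons i l ih =>
    rw [List.map_cons, List.sum_cons] at hl
    rw [List.map_cons, List.prod_cons]
    rcases Nat.even_or_odd (deg i) with hi | hi
    · rw [hd.map_gen_mul_of_even hi, map_add, oddCoeff_mul, oddCoeff_mul]
      have ih' := ih ((Nat.even_add.mp hl).mp hi) fun k hk => h k (List.mem_cons_of_mem _ hk)
      exact J.add_mem (J.add_mem (J.mul_mem_right _ (h i List.mem_cons_self hi))
        (J.mul_mem_right _ (hJ _))) (J.add_mem (J.mul_mem_left _ (hJ _)) (J.mul_mem_left _ ih'))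
    · have hl' : Odd (l.map deg).sum := by
        rw [← Nat.not_even_iff_odd] at hi ⊢
        exact fun hcon => hi ((Nat.even_add.mp hl).mpr hcon)
      rw [hd.map_gen_mul_of_odd hi, map_sub, oddCoeff_mul, oddCoeff_mul,
        evenProj_list_prod_of_odd hl', evenProj_gen_of_odd hi, mul_zero, zero_mul, zero_add,
        add_zero]
      exact J.sub_mem (J.mul_mem_right _ (hJ _)) (J.mul_mem_left _ (hJ _))

end oddCoeff

/-! ### Homogeneous quadratic elements -/

/-- The homomorphism `ΛW → ΛW[t]` that multiplies homogeneous elements of degree `k` by `t ^ k`. -/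
noncomputable def gradingHom (deg : ι → ℕ) : FreeGCA deg →ₐ[ℚ] Polynomial (FreeGCA deg) :=
  lift deg (fun i => Polynomial.monomial (deg i) (gen deg i)) fun i j => by
    rw [Polynomial.monomial_mul_monomial, Polynomial.monomial_mul_monomial, gen_mul_gen,
      add_comm (deg i), Polynomial.smul_monomial]

theorem gradingHom_list_prod (l : List ι) : gradingHom deg (l.map (gen deg)).prod =
    Polynomial.monomial (l.map deg).sum (l.map (gen deg)).prod := by
  induction l with
  | nil => simp
  | cons i l ih =>
    rw [List.map_cons, List.prod_cons, map_mul, ih, gradingHom, lift_gen,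
      Polynomial.monomial_mul_monomial]
    simp

theorem coeff_gradingHom {k : ℕ} {x : FreeGCA deg} (hx : x ∈ degreePart deg k) :
    (gradingHom deg x).coeff k = x := by
  have h := map_mem_of_list_prod (((Polynomial.lcoeff (FreeGCA deg) k).restrictScalars ℚ ∘ₗ
    (gradingHom deg).toLinearMap) - LinearMap.id) ⊥ (fun l (hl : (l.map deg).sum = k) => by
      simp [gradingHom_list_prod, hl]) hx
  simpa [sub_eq_zero] using h

open Classical in
/-- A homogeneous element of `Λ²U` is a combination of products of two generators of `U` of the
right total degree. -/
theorem exists_coeff_of_mem_lengthPartOn_two [Fintype ι] {S : Set ι} {k : ℕ} {x : FreeGCA deg}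
    (hx : x ∈ lengthPartOn deg S 2) (hk : x ∈ degreePart deg k) :
    ∃ c : ι → ι → ℚ, (∀ i j, c i j ≠ 0 → deg i + deg j = k ∧ i ∈ S ∧ j ∈ S) ∧
      x = ∑ i, ∑ j, c i j • (gen deg i * gen deg j) := by
  let v : ι × ι → FreeGCA deg := fun p =>
    if p.1 ∈ S ∧ p.2 ∈ S then gen deg p.1 * gen deg p.2 else 0
  have hle : lengthPartOn deg S 2 ≤ Submodule.span ℚ (Set.range v) := by
    rw [lengthPartOn, monomialSpan, Submodule.span_le]
    rintro _ ⟨l, ⟨hl, hS⟩, rfl⟩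
    obtain ⟨i, j, rfl⟩ := List.length_eq_two.mp hl
    refine Submodule.subset_span ⟨(i, j), ?_⟩
    have hi := hS i (by simp)
    have hj := hS j (by simp)
    simp [v, hi, hj]
  obtain ⟨c, hc⟩ := (Submodule.mem_span_range_iff_exists_fun ℚ).mp (hle hx)
  refine ⟨fun i j => if deg i + deg j = k ∧ i ∈ S ∧ j ∈ S then c (i, j) else 0,
    fun i j hij => ?_, ?_⟩
  · by_contra hcon
    exact hij (if_neg hcon)
  · have hcoeff (i j : ι) : (gradingHom deg (gen deg i * gen deg j)).coeff k =
        if deg i + deg j = k then gen deg i * gen deg j else 0 := by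
      have := gradingHom_list_prod (deg := deg) [i, j]
      simp only [List.map_cons, List.map_nil, List.prod_cons, List.prod_nil, mul_one,
        List.sum_cons, List.sum_nil, add_zero] at this
      rw [this, Polynomial.coeff_monomial]
    rw [← coeff_gradingHom hk, ← hc, map_sum, Polynomial.finsetSum_coeff, Fintype.sum_prod_type]
    refine Finset.sum_congr rfl fun i _ => Finset.sum_congr rfl fun j _ => ?_
    rw [map_smul, Polynomial.coeff_smul]
    by_cases hS : i ∈ S ∧ j ∈ S
    · have hv : v (i, j) = gen deg i * gen deg j := if_pos hS
      rw [hv, hcoeff]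
      by_cases hd : deg i + deg j = k <;> simp [hS, hd]
    · have hv : v (i, j) = 0 := if_neg hS
      simp [hv, hS]

end FreeGCA

/-! ### Parity of `V` in elliptic models -/

namespace TwoStageMinimalModel

open FreeGCA

variable (M : TwoStageMinimalModel)

/-- The degrees of all generators of a two-stage model. -/
abbrev deg : Fin M.dimU ⊕ Fin M.dimV → ℕ := Sum.elim M.degU M.degV

theorem IsQuadratic.exists_coeff {M : TwoStageMinimalModel} (hquad : M.IsQuadratic)
    (j : Fin M.dimV) : ∃ c : Fin M.dimU → Fin M.dimU → ℚ,
      (∀ i k, c i k ≠ 0 → M.degU i + M.degU k = M.degV j + 1) ∧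
      M.d (gen M.deg (Sum.inr j)) =
        ∑ i, ∑ k, c i k • (gen M.deg (Sum.inl i) * gen M.deg (Sum.inl k)) := by
  obtain ⟨c, hc, h⟩ := exists_coeff_of_mem_lengthPartOn_two (hquad j)
    (M.isDifferential.map_gen_mem (Sum.inr j))
  refine ⟨fun i k => c (Sum.inl i) (Sum.inl k), fun i k hik => (hc _ _ hik).1, ?_⟩
  have h0 (x y) (hxy : ¬ (x ∈ Set.range Sum.inl ∧ y ∈ Set.range Sum.inl)) : c x y = 0 := by
    by_contra hne
    exact hxy (hc x y hne).2
  rw [h]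
  simp only [Fintype.sum_sum_type]
  simp [h0]

/-- In an elliptic two-stage model with quadratic differential, `V` is concentrated in odd degrees.
If `y` in `V` had even degree, then `dy = ∑ xᵢ uᵢ` with `xᵢ` even and `uᵢ` odd in `U`, and a
polynomial in `y` would lie in `im d + (xᵢ)`, hence in the ideal generated by `U`. -/
theorem IsElliptic.odd_degV {M : TwoStageMinimalModel} (hell : M.IsElliptic)
    (hquad : M.IsQuadratic) (j : Fin M.dimV) : Odd (M.degV j) := by
  classical
  by_contra hodd
  have heven : Even (M.deg (Sum.inr j)) := Nat.not_odd_iff_even.mp hodd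
  obtain ⟨c, hc, hdy⟩ := hquad.exists_coeff j
  have hd := M.isDifferential
  -- evaluation at zero of all generators but `y`
  let ρ : FreeGCA M.deg →ₐ[ℚ] Polynomial ℚ :=
    liftComm M.deg (fun i => if i = Sum.inr j then Polynomial.X else 0) (by
      intro i k hi hk
      have : i ≠ Sum.inr j := by rintro rfl; exact hodd hi
      simp [this])
  have hρU (i) : ρ (gen M.deg (Sum.inl i)) = 0 := by simp [ρ]
  have hρd (z) : ρ (M.d z) = 0 := by
    refine hd.algHom_mem ρ ⊥ (fun i => ?_) z
    rcases i with i | i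
    · rw [M.d_U, map_zero]; exact Submodule.zero_mem _
    · obtain ⟨c', -, h'⟩ := hquad.exists_coeff i
      rw [h']
      simp [hρU]
  have hsplit : ∀ p : Fin M.dimU × Fin M.dimU, ∃ x u : FreeGCA M.deg,
      x * u = c p.1 p.2 • (gen M.deg (Sum.inl p.1) * gen M.deg (Sum.inl p.2)) ∧
      (∃ (r : ℚ) (i : _), (r = 0 ∨ Even (M.degU i)) ∧ x = r • gen M.deg (Sum.inl i)) ∧
      (∃ (r : ℚ) (i : _), (r = 0 ∨ Odd (M.degU i)) ∧ u = r • gen M.deg (Sum.inl i)) := by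
    rintro ⟨i, k⟩
    by_cases h0 : c i k = 0
    · exact ⟨0, 0, by simp [h0], ⟨0, i, by simp⟩, ⟨0, i, by simp⟩⟩
    · have hsum : Odd (M.degU i + M.degU k) := by
        rw [hc i k h0]
        exact heven.add_one
      rcases Nat.even_or_odd (M.degU i) with hi | hi
      · refine ⟨gen M.deg (Sum.inl i), c i k • gen M.deg (Sum.inl k), by simp,
          ⟨1, i, Or.inr hi, by simp⟩, ⟨c i k, k, Or.inr ?_, rfl⟩⟩
        rw [Nat.odd_add'] at hsum
        exact hsum.mpr hi
      · have hk : Even (M.degU k) := (Nat.odd_add.mp hsum).mp hi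
        refine ⟨gen M.deg (Sum.inl k), c i k • gen M.deg (Sum.inl i), ?_,
          ⟨1, k, Or.inr hk, by simp⟩, ⟨c i k, i, Or.inr hi, rfl⟩⟩
        rw [mul_smul_comm, gen_mul_comm_of_even (i := Sum.inl k) hk]
  choose x u hxu hx hu using hsplit
  have hx_comm (p z) : x p * z = z * x p := by
    obtain ⟨r, i, hr | hi, h⟩ := hx p
    · simp [h, hr]
    · rw [h, smul_mul_assoc, mul_smul_comm, gen_mul_comm_of_even (i := Sum.inl i) hi]
  have hx_d (p z) : M.d (x p * z) = x p * M.d z := by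
    obtain ⟨r, i, hr | hi, h⟩ := hx p
    · simp [h, hr]
    · rw [h, smul_mul_assoc, map_smul, hd.map_gen_mul_of_even (i := Sum.inl i) hi, M.d_U]
      simp
  have hu_d (p z) : M.d (u p * z) = -(u p * M.d z) := by
    obtain ⟨r, i, hr | hi, h⟩ := hu p
    · simp [h, hr]
    · rw [h, smul_mul_assoc, map_smul, hd.map_gen_mul_of_odd (i := Sum.inl i) hi, M.d_U]
      simp
  have hu_u (p q) : u p * u q = -(u q * u p) := by
    obtain ⟨r, i, hr | hi, h⟩ := hu p
    · simp [h, hr]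
    obtain ⟨s, k, hs | hk, h'⟩ := hu q
    · simp [h', hs]
    · rw [h, h', smul_mul_smul_comm, smul_mul_smul_comm,
        gen_mul_gen_of_odd (i := Sum.inl i) (j := Sum.inl k) hi hk, mul_comm r, smul_neg]
  have hy (z) : gen M.deg (Sum.inr j) * z = z * gen M.deg (Sum.inr j) :=
    gen_mul_comm_of_even heven z
  obtain ⟨p, hp, hpN⟩ := exists_aeval_mem_of_commutator
    (Finset.univ : Finset (Fin M.dimU × Fin M.dimU)).toList M.d
    (LinearMap.mulLeft ℚ (gen M.deg (Sum.inr j)))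
    (fun p => LinearMap.mulLeft ℚ (x p)) (fun p => LinearMap.mulLeft ℚ (u p))
    (cocycleClasses_fg M.d hell) 1 hd.map_one
    (fun p z => hx_d p z) (fun p z => hu_d p z)
    (fun p q z => by simp only [LinearMap.mulLeft_apply, ← mul_assoc, hx_comm p])
    (fun p q z => by simp only [LinearMap.mulLeft_apply, ← mul_assoc, hx_comm p])
    (fun p z => by simp only [LinearMap.mulLeft_apply, ← mul_assoc, hx_comm p])
    (fun p z => by simp only [LinearMap.mulLeft_apply, ← mul_assoc, hy])
    (fun p q z => by simp only [LinearMap.mulLeft_apply, ← mul_assoc, hu_u p q, neg_mul])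
    (fun z => by
      simp only [LinearMap.mulLeft_apply, ← mul_assoc, hxu]
      rw [Finset.sum_map_toList, hd.map_gen_mul_of_even heven, hdy, ← Finset.sum_mul,
        Fintype.sum_prod_type, add_comm])
    (LinearMap.ker ρ.toLinearMap)
    (by rintro _ ⟨z, rfl⟩; exact hρd z)
    (by
      rintro p _ ⟨z, rfl⟩
      obtain ⟨r, i, -, h⟩ := hx p
      simp [h, hρU])
  apply hp
  have h1 : Polynomial.aeval (LinearMap.mulLeft ℚ (gen M.deg (Sum.inr j))) p (1 : FreeGCA M.deg) =
      Polynomial.aeval (gen M.deg (Sum.inr j)) p := by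
    have := Polynomial.aeval_algHom_apply (Algebra.lmul ℚ (FreeGCA M.deg))
      (gen M.deg (Sum.inr j)) p
    exact (LinearMap.congr_fun this 1).trans (mul_one _)
  have h2 : ρ (Polynomial.aeval (gen M.deg (Sum.inr j)) p) = 0 := by
    rw [← h1]; exact hpN
  rw [← Polynomial.aeval_algHom_apply] at h2
  simpa [ρ] using h2

end TwoStageMinimalModel

/-! ### Changes of coordinates and maximality of `V` -/

namespace FreeGCA

variable {ι κ : Type*} {deg : ι → ℕ} {deg' : κ → ℕ}

theorem gen_mul_of_mem_degreePart {k : ℕ} (i : ι) {y : FreeGCA deg} (hy : y ∈ degreePart deg k) :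
    gen deg i * y = (-1 : ℚ) ^ (deg i * k) • (y * gen deg i) := by
  have := map_mem_of_list_prod (LinearMap.mulLeft ℚ (gen deg i) -
    (-1 : ℚ) ^ (deg i * k) • LinearMap.mulRight ℚ (gen deg i)) ⊥
    (fun l (hl : (l.map deg).sum = k) => by
      subst hl
      clear hy
      induction l with
      | nil => simp
      | cons j l ih =>
        simp only [LinearMap.sub_apply, LinearMap.smul_apply, LinearMap.mulLeft_apply,
          LinearMap.mulRight_apply, Submodule.mem_bot, sub_eq_zero, List.map_cons, List.prod_cons,
          List.sum_cons] at ih ⊢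
        rw [← mul_assoc, gen_mul_gen, smul_mul_assoc, mul_assoc, ih, mul_smul_comm, smul_smul,
          ← pow_add, ← mul_add, mul_assoc]) hy
  simpa [sub_eq_zero] using this

/-- Graded commutativity of `ΛW`. -/
theorem mul_comm_of_mem_degreePart {k l : ℕ} {x y : FreeGCA deg} (hx : x ∈ degreePart deg k)
    (hy : y ∈ degreePart deg l) : x * y = (-1 : ℚ) ^ (k * l) • (y * x) := by
  have := map_mem_of_list_prod (LinearMap.mulRight ℚ y -
    (-1 : ℚ) ^ (k * l) • LinearMap.mulLeft ℚ y) ⊥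
    (fun m (hm : (m.map deg).sum = k) => by
      subst hm
      clear hx
      induction m with
      | nil => simp
      | cons j m ih =>
        simp only [LinearMap.sub_apply, LinearMap.smul_apply, LinearMap.mulLeft_apply,
          LinearMap.mulRight_apply, Submodule.mem_bot, sub_eq_zero, List.map_cons, List.prod_cons,
          List.sum_cons] at ih ⊢
        rw [mul_assoc, ih, mul_smul_comm, ← mul_assoc, gen_mul_of_mem_degreePart j hy,
          smul_mul_assoc, smul_smul, mul_assoc, ← pow_add, add_comm, ← add_mul]) hx
  simpa [sub_eq_zero] using this

/-- The homomorphism `ΛW → ΛW'` given by homogeneous images of the generators. -/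
noncomputable def liftHomogeneous (f : ι → FreeGCA deg') (hf : ∀ i, f i ∈ degreePart deg' (deg i)) :
    FreeGCA deg →ₐ[ℚ] FreeGCA deg' :=
  lift deg f fun i j => mul_comm_of_mem_degreePart (hf i) (hf j)

@[simp]
theorem liftHomogeneous_gen (f : ι → FreeGCA deg') (hf : ∀ i, f i ∈ degreePart deg' (deg i))
    (i : ι) : liftHomogeneous f hf (gen deg i) = f i :=
  lift_gen deg f _ i

theorem liftHomogeneous_mem (f : ι → FreeGCA deg') (hf : ∀ i, f i ∈ degreePart deg' (deg i))
    {k : ℕ} {x : FreeGCA deg} (hx : x ∈ degreePart deg k) :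
    liftHomogeneous f hf x ∈ degreePart deg' k := by
  refine map_mem_of_list_prod (liftHomogeneous f hf).toLinearMap _
    (fun l (hl : (l.map deg).sum = k) => ?_) hx
  subst hl
  clear hx
  induction l with
  | nil => simpa using one_mem_degreePart
  | cons i l ih =>
    have := mul_mem_degreePart (hf i) ih
    simpa using this

end FreeGCA

namespace TwoStageMinimalModel

open FreeGCA

/-- If a homogeneous odd functional `μ` on `U` annihilates all contractions of `dV ⊆ Λ²U`, then
`dV ⊆ Λ²(ker μ)`, and a complement of `ker μ` can be moved from `U` to `V`: so `V` is not of
maximal dimension. -/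
theorem HasMaximalV.false_of_functional {M : TwoStageMinimalModel} (hmax : M.HasMaximalV)
    (c : Fin M.dimV → Fin M.dimU → Fin M.dimU → ℚ)
    (hc : ∀ j i k, c j i k ≠ 0 → (Odd (M.degU i) ↔ Odd (M.degU k)))
    (hdc : ∀ j, M.d (gen M.deg (Sum.inr j)) =
      ∑ i, ∑ k, c j i k • (gen M.deg (Sum.inl i) * gen M.deg (Sum.inl k)))
    (i₀ : Fin M.dimU) (hi₀ : Odd (M.degU i₀)) (μ : Fin M.dimU → ℚ) (hμ₀ : μ i₀ = 1)
    (hμ : ∀ i, μ i ≠ 0 → M.degU i = M.degU i₀)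
    (hμc : ∀ j k, ∑ i, μ i * (c j i k - c j k i) = 0) : False := by
  classical
  have hd := M.isDifferential
  obtain ⟨e⟩ : Nonempty (Fin (M.dimU - 1) ≃ {i : Fin M.dimU // i ≠ i₀}) := by
    refine ⟨(Fintype.equivFinOfCardEq ?_).symm⟩
    rw [Fintype.card_subtype_compl]
    simp
  let degU' : Fin (M.dimU - 1) → ℕ := fun a => M.degU (e a)
  let degV' : Fin (M.dimV + 1) → ℕ := Fin.cons (M.degU i₀) M.degV
  let deg' := Sum.elim degU' degV'
  let v₀ : FreeGCA deg' := gen deg' (Sum.inr 0)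
  have hv₀ : v₀ ∈ degreePart deg' (M.degU i₀) := gen_mem_degreePart (deg := deg') (Sum.inr 0)
  -- `A i` is the component of the old generator `i` in the new space `U`, and `G` the change of
  -- coordinates; its inverse is `F`
  let A : Fin M.dimU → FreeGCA deg' := fun i =>
    if h : i ≠ i₀ then gen deg' (Sum.inl (e.symm ⟨i, h⟩)) else 0
  have hA₀ : A i₀ = 0 := by simp [A]
  have hA : ∀ i, A i ∈ degreePart deg' (M.degU i) := by
    intro i
    by_cases h : i ≠ i₀
    · have := gen_mem_degreePart (deg := deg') (Sum.inl (e.symm ⟨i, h⟩))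
      simpa [A, h, deg', degU'] using this
    · rw [not_not.mp h, hA₀]
      exact Submodule.zero_mem _
  let G : Fin M.dimU ⊕ Fin M.dimV → FreeGCA deg' :=
    Sum.elim (fun i => A i + μ i • v₀) fun j => gen deg' (Sum.inr j.succ)
  have hG : ∀ i, G i ∈ degreePart deg' (M.deg i) := by
    rintro (i | j)
    · refine Submodule.add_mem _ (hA i) ?_
      by_cases h : μ i = 0
      · simp [h]
      · exact Submodule.smul_mem _ _ (by simpa [hμ i h] using hv₀)
    · exact gen_mem_degreePart (deg := deg') (Sum.inr j.succ)
  let F : Fin (M.dimU - 1) ⊕ Fin (M.dimV + 1) → FreeGCA M.deg :=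
    Sum.elim (fun a => gen M.deg (Sum.inl (e a)) - μ (e a) • gen M.deg (Sum.inl i₀))
      (Fin.cons (gen M.deg (Sum.inl i₀)) fun j => gen M.deg (Sum.inr j))
  have hF : ∀ i, F i ∈ degreePart M.deg (deg' i) := by
    rintro (a | j)
    · refine Submodule.sub_mem _ (gen_mem_degreePart (deg := M.deg) (Sum.inl (e a).1)) ?_
      by_cases h : μ (e a) = 0
      · simp [h]
      · refine Submodule.smul_mem _ _ ?_
        have := gen_mem_degreePart (deg := M.deg) (Sum.inl i₀)
        simpa [deg', degU', hμ _ h] using this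
    · refine Fin.cases ?_ (fun j => ?_) j
      · exact gen_mem_degreePart (deg := M.deg) (Sum.inl i₀)
      · exact gen_mem_degreePart (deg := M.deg) (Sum.inr j)
  let f := liftHomogeneous F hF
  let g := liftHomogeneous G hG
  have hAe (a) : A (e a) = gen deg' (Sum.inl a) := by
    simp [A, (e a).2]
  have hgf : ∀ x, g (f x) = x := by
    have : g.comp f = AlgHom.id ℚ _ := by
      refine algHom_ext ?_
      rintro (a | j)
      · simp [f, g, F, G, hA₀, hAe, hμ₀]
      · refine Fin.cases ?_ (fun j => ?_) j
        · simp [f, g, F, G, hA₀, hμ₀, v₀]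
        · simp [f, g, F, G]
    exact DFunLike.congr_fun this
  have hfg : ∀ x, f (g x) = x := by
    have : f.comp g = AlgHom.id ℚ _ := by
      refine algHom_ext ?_
      rintro (i | j)
      · by_cases h : i = i₀
        · subst h
          simp [f, g, F, G, hA₀, hμ₀, v₀]
        · simp [f, g, F, G, A, h, v₀]
      · simp [f, g, F, G]
    exact DFunLike.congr_fun this
  let d' : FreeGCA deg' →ₗ[ℚ] FreeGCA deg' := g.toLinearMap ∘ₗ M.d ∘ₗ f.toLinearMap
  have hd'_apply (x) : d' x = g (M.d (f x)) := rfl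
  have hd' : IsDifferential deg' d' := by
    refine ⟨fun k x hx => ?_, fun k x y hx => ?_, fun x => ?_⟩
    · exact liftHomogeneous_mem G hG (hd.map_degree k _ (liftHomogeneous_mem F hF hx))
    · have := hd.leibniz k (f x) (f y) (liftHomogeneous_mem F hF hx)
      simp [hd'_apply, this, hgf]
    · rw [hd'_apply, hd'_apply, hfg, hd.sq_zero, map_zero]
  -- in the new coordinates `v₀` does not occur in `dV`
  have hdV : ∀ j, g (M.d (gen M.deg (Sum.inr j))) = ∑ i, ∑ k, c j i k • (A i * A k) := by
    intro j
    have hv₀v₀ : v₀ * v₀ = 0 := by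
      have h := gen_mul_gen_of_odd (deg := deg') (i := Sum.inr 0) (j := Sum.inr 0) hi₀ hi₀
      have h2 : (2 : ℚ) • (v₀ * v₀) = 0 := by
        rw [two_smul]
        exact add_eq_zero_iff_eq_neg.mpr h
      exact (smul_eq_zero.mp h2).resolve_left two_ne_zero
    have hterm (i k) : c j i k • ((A i + μ i • v₀) * (A k + μ k • v₀)) =
        c j i k • (A i * A k) + ((μ i * c j i k) • (v₀ * A k) - (μ k * c j i k) • (v₀ * A i)) := by
      have h1 : (c j i k * μ k) • (A i * v₀) = -((μ k * c j i k) • (v₀ * A i)) := by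
        by_cases h0 : c j i k = 0
        · simp [h0]
        by_cases hk : μ k = 0
        · simp [hk]
        have hodd : Odd (M.degU i) := (hc j i k h0).mpr (hμ k hk ▸ hi₀)
        rw [mul_comm_of_mem_degreePart (hA i) hv₀, (hodd.mul hi₀).neg_one_pow, neg_one_smul,
          smul_neg, mul_comm]
      rw [add_mul, mul_add, mul_add, smul_mul_smul_comm, hv₀v₀, smul_zero, add_zero, smul_add,
        smul_add, mul_smul_comm, smul_smul, h1, smul_mul_assoc, smul_smul, mul_comm (c j i k)]
      abel
    rw [hdc j]
    simp only [map_sum, map_smul, map_mul]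
    have hg (i) : g (gen M.deg (Sum.inl i)) = A i + μ i • v₀ := by simp [g, G]
    simp only [hg, hterm, Finset.sum_add_distrib, Finset.sum_sub_distrib]
    have h2 : ∑ i, ∑ k, (μ i * c j i k) • (v₀ * A k) - ∑ i, ∑ k, (μ k * c j i k) • (v₀ * A i) =
        ∑ k, (∑ i, μ i * (c j i k - c j k i)) • (v₀ * A k) := by
      rw [Finset.sum_comm, ← Finset.sum_sub_distrib]
      refine Finset.sum_congr rfl fun k _ => ?_
      rw [← Finset.sum_sub_distrib, Finset.sum_smul]
      refine Finset.sum_congr rfl fun i _ => ?_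
      rw [← sub_smul, mul_sub]
    -- the coefficients of `v₀ * A k` are the contractions of `dV` with `μ`
    rw [h2]
    simp [hμc]
  have hdV_mem (j) {P : List (Fin (M.dimU - 1) ⊕ Fin (M.dimV + 1)) → Prop}
      (hP : ∀ a b, P [Sum.inl a, Sum.inl b]) :
      g (M.d (gen M.deg (Sum.inr j))) ∈ monomialSpan deg' P := by
    rw [hdV]
    refine Submodule.sum_mem _ fun i _ => Submodule.sum_mem _ fun k _ => Submodule.smul_mem _ _ ?_
    by_cases hi : i ≠ i₀
    · by_cases hk : k ≠ i₀
      · have := list_prod_mem_monomialSpan (deg := deg') (hP (e.symm ⟨i, hi⟩) (e.symm ⟨k, hk⟩))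
        simpa [A, hi, hk] using this
      · rw [not_not.mp hk, hA₀, mul_zero]
        exact Submodule.zero_mem _
    · rw [not_not.mp hi, hA₀, zero_mul]
      exact Submodule.zero_mem _
  have hfinl (a) : f (gen deg' (Sum.inl a)) =
      gen M.deg (Sum.inl (e a)) - μ (e a) • gen M.deg (Sum.inl i₀) := by simp [f, F]
  have hfzero : f (gen deg' (Sum.inr 0)) = gen M.deg (Sum.inl i₀) := by simp [f, F]
  have hfsucc (j : Fin M.dimV) : f (gen deg' (Sum.inr j.succ)) = gen M.deg (Sum.inr j) := by
    simp [f, F]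
  have hd'V (j) {P : List (Fin (M.dimU - 1) ⊕ Fin (M.dimV + 1)) → Prop}
      (hP : ∀ a b, P [Sum.inl a, Sum.inl b]) : d' (gen deg' (Sum.inr j)) ∈ monomialSpan deg' P := by
    rw [hd'_apply]
    refine Fin.cases ?_ (fun j => ?_) j
    · rw [hfzero, M.d_U, map_zero]
      exact Submodule.zero_mem _
    · rw [hfsucc]
      exact hdV_mem j hP
  let M' : TwoStageMinimalModel :=
    { dimU := M.dimU - 1
      dimV := M.dimV + 1
      degU := degU'
      degV := degV'
      degU_pos := fun a => M.degU_pos _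
      degV_pos := fun j => by
        refine Fin.cases ?_ (fun j => ?_) j
        · exact M.degU_pos i₀
        · exact M.degV_pos j
      d := d'
      isDifferential := hd'
      d_U := fun a => by
        change g (M.d (f (gen deg' (Sum.inl a)))) = 0
        rw [hfinl, map_sub, map_smul, M.d_U, M.d_U, smul_zero, sub_zero, map_zero]
      d_V := fun j => hd'V j fun a b i hi => by
        simp only [List.mem_cons, List.not_mem_nil, or_false] at hi
        rcases hi with rfl | rfl
        exacts [⟨a, rfl⟩, ⟨b, rfl⟩]
      minimal := fun j => hd'V j fun a b => le_rfl }
  have hiso : DGAIsomorphic M'.d M.d :=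
    ⟨AlgEquiv.ofAlgHom f g (AlgHom.ext hfg) (AlgHom.ext hgf),
      fun k x hx => liftHomogeneous_mem F hF hx, fun x => hfg _⟩
  exact absurd (hmax M' hiso) (Nat.not_succ_le_self M.dimV)

end TwoStageMinimalModel

namespace TwoStageMinimalModel

open FreeGCA

/-- If `V` is of maximal dimension and in odd degrees, the contractions of `dV ⊆ Λ²U` with odd
functionals span the odd part of `U`. -/
theorem HasMaximalV.single_mem_span {M : TwoStageMinimalModel} (hmax : M.HasMaximalV)
    (hV : ∀ j, Odd (M.degV j)) (c : Fin M.dimV → Fin M.dimU → Fin M.dimU → ℚ)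
    (hc : ∀ j i k, c j i k ≠ 0 → M.degU i + M.degU k = M.degV j + 1)
    (hdc : ∀ j, M.d (gen M.deg (Sum.inr j)) =
      ∑ i, ∑ k, c j i k • (gen M.deg (Sum.inl i) * gen M.deg (Sum.inl k)))
    (i₀ : Fin M.dimU) (hi₀ : Odd (M.degU i₀)) :
    (Pi.single i₀ 1 : Fin M.dimU → ℚ) ∈ Submodule.span ℚ
      {w | ∃ j k, Odd (M.degU k) ∧ w = fun i => c j i k - c j k i} := by
  classical
  by_contra hcon
  obtain ⟨f, hf, hker⟩ := Submodule.exists_le_ker_of_notMem hcon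
  have hparity (j i k) (h : c j i k ≠ 0) : Odd (M.degU i) ↔ Odd (M.degU k) := by
    have h1 := hc j i k h
    have h2 : Even (M.degU i + M.degU k) := h1 ▸ (hV j).add_one
    exact Nat.even_add'.mp h2
  -- the component of `f` in the degree of `i₀` still annihilates the contractions, as these are
  -- homogeneous
  let μ : Fin M.dimU → ℚ := fun i =>
    if M.degU i = M.degU i₀ then f (Pi.single i 1) / f (Pi.single i₀ 1) else 0
  refine hmax.false_of_functional c hparity hdc i₀ hi₀ μ ?_ ?_ ?_
  · simp [μ, hf]
  · intro i hi
    by_contra h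
    exact hi (if_neg h)
  intro j k
  by_cases hk : Odd (M.degU k)
  · by_cases hdeg : M.degU i₀ + M.degU k = M.degV j + 1
    · have hrow : f (fun i => c j i k - c j k i) = 0 :=
        hker (Submodule.subset_span ⟨j, k, hk, rfl⟩)
      rw [LinearMap.pi_apply_eq_sum_univ] at hrow
      have : ∑ i, μ i * (c j i k - c j k i) = (∑ i, (c j i k - c j k i) •
          f (fun l => if i = l then 1 else 0)) / f (Pi.single i₀ 1) := by
        rw [Finset.sum_div]
        refine Finset.sum_congr rfl fun i _ => ?_
        have hs : (fun l => if i = l then (1 : ℚ) else 0) = Pi.single i 1 := by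
          ext l; simp [Pi.single_apply, eq_comm]
        rw [hs]
        by_cases hi : M.degU i = M.degU i₀
        · simp only [μ, if_pos hi, smul_eq_mul]; ring
        · have h1 : c j i k = 0 := by
            by_contra h; have := hc j i k h; omega
          have h2 : c j k i = 0 := by
            by_contra h; have := hc j k i h; omega
          simp [h1, h2]
      rw [this, hrow, zero_div]
    · refine Finset.sum_eq_zero fun i _ => ?_
      by_cases hi : M.degU i = M.degU i₀
      · have h1 : c j i k = 0 := by
          by_contra h; have := hc j i k h; omega
        have h2 : c j k i = 0 := by
          by_contra h; have := hc j k i h; omega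
        simp [h1, h2]
      · simp [μ, hi]
  · refine Finset.sum_eq_zero fun i _ => ?_
    by_cases hi : M.degU i = M.degU i₀
    · have hi' : Odd (M.degU i) := hi ▸ hi₀
      have h1 : c j i k = 0 := by
        by_contra h; exact hk ((hparity j i k h).mp hi')
      have h2 : c j k i = 0 := by
        by_contra h; exact hk ((hparity j k i h).mpr hi')
      simp [h1, h2]
    · simp [μ, hi]

end TwoStageMinimalModel

/-! ### The fibre of an extension -/

namespace FreeGCA

variable {ι κ : Type*} {deg₁ : ι → ℕ} {deg₂ : κ → ℕ}

/-- The inclusion `ΛW₂ → ΛW₁ ⊗ ΛW₂` of algebras. -/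
noncomputable def fibreSection (deg₁ : ι → ℕ) (deg₂ : κ → ℕ) :
    FreeGCA deg₂ →ₐ[ℚ] FreeGCA (Sum.elim deg₁ deg₂) :=
  lift deg₂ (fun j => gen (Sum.elim deg₁ deg₂) (Sum.inr j)) fun i j =>
    gen_mul_gen (Sum.elim deg₁ deg₂) (Sum.inr i) (Sum.inr j)

@[simp]
theorem fibreSection_gen (j : κ) : fibreSection deg₁ deg₂ (gen deg₂ j) =
    gen (Sum.elim deg₁ deg₂) (Sum.inr j) :=
  lift_gen deg₂ _ _ j

@[simp]
theorem fibreProjection_fibreSection (x : FreeGCA deg₂) :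
    fibreProjection deg₁ deg₂ (fibreSection deg₁ deg₂ x) = x := by
  have : (fibreProjection deg₁ deg₂).comp (fibreSection deg₁ deg₂) = AlgHom.id ℚ _ :=
    algHom_ext fun i => by simp
  exact DFunLike.congr_fun this x

/-- An element differs from its image in the fibre by monomials that contain a generator of
the base. -/
theorem sub_fibreSection_mem {P : List (ι ⊕ κ) → Prop} {z : FreeGCA (Sum.elim deg₁ deg₂)}
    (hz : z ∈ monomialSpan (Sum.elim deg₁ deg₂) P) :
    z - fibreSection deg₁ deg₂ (fibreProjection deg₁ deg₂ z) ∈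
      monomialSpan (Sum.elim deg₁ deg₂) fun l => P l ∧ ∃ a, Sum.inl a ∈ l := by
  refine map_mem_of_list_prod (LinearMap.id - (fibreSection deg₁ deg₂).toLinearMap ∘ₗ
    (fibreProjection deg₁ deg₂).toLinearMap) _ (fun l hl => ?_) hz
  simp only [LinearMap.sub_apply, LinearMap.id_apply, LinearMap.comp_apply,
    AlgHom.toLinearMap_apply]
  by_cases h : ∃ a, Sum.inl a ∈ l
  · obtain ⟨a, ha⟩ := h
    have h0 : fibreProjection deg₁ deg₂ (l.map (gen (Sum.elim deg₁ deg₂))).prod = 0 := by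
      rw [map_list_prod]
      refine List.prod_eq_zero ?_
      rw [List.map_map, List.mem_map]
      exact ⟨_, ha, by simp⟩
    rw [h0, map_zero, sub_zero]
    exact list_prod_mem_monomialSpan (P := fun l => P l ∧ ∃ a, Sum.inl a ∈ l) ⟨hl, a, ha⟩
  · have h0 : fibreSection deg₁ deg₂ (fibreProjection deg₁ deg₂
        (l.map (gen (Sum.elim deg₁ deg₂))).prod) = (l.map (gen (Sum.elim deg₁ deg₂))).prod := by
      clear hl
      induction l with
      | nil => simp
      | cons i l ih =>
        rcases i with a | j
        · exact absurd ⟨a, List.mem_cons_self⟩ h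
        · rw [List.map_cons, List.prod_cons, map_mul, map_mul, ih, fibreProjection_gen_inr,
            fibreSection_gen]
          rintro ⟨a, ha⟩
          exact h ⟨a, List.mem_cons_of_mem _ ha⟩
    rw [h0, sub_self]
    exact Submodule.zero_mem _

/-- An even generator can be split off a monomial. -/
theorem exists_list_prod_eq_gen_mul {deg : ι → ℕ} {i : ι} (hi : Even (deg i)) {l : List ι}
    (h : i ∈ l) : ∃ l' : List ι, l.Perm (i :: l') ∧
      (l.map (gen deg)).prod = gen deg i * (l'.map (gen deg)).prod := by
  obtain ⟨l₁, l₂, rfl⟩ := List.mem_iff_append.mp h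
  refine ⟨l₁ ++ l₂, List.perm_middle, ?_⟩
  simp only [List.map_append, List.map_cons, List.prod_append, List.prod_cons]
  rw [← mul_assoc, ← gen_mul_comm_of_even hi, mul_assoc]

end FreeGCA

/-! ### Relations from `D² = 0` in an extension -/

namespace FreeGCA

variable {ι : Type*} {deg : ι → ℕ}

/-- The ideal generated by the even parts of the differentials of the generators. -/
noncomputable def evenIdeal (d : FreeGCA deg →ₗ[ℚ] FreeGCA deg) : Ideal (EvenPoly deg) :=
  Ideal.span (Set.range fun i => evenProj deg (d (gen deg i)))

theorem IsDifferential.evenProj_mem {d : FreeGCA deg →ₗ[ℚ] FreeGCA deg}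
    (hd : IsDifferential deg d) (x : FreeGCA deg) : evenProj deg (d x) ∈ evenIdeal d :=
  hd.algHom_mem (evenProj deg) (evenIdeal d) (fun i => Ideal.subset_span ⟨i, rfl⟩) x

theorem IsDifferential.constantCoeff_evenProj_gen {d : FreeGCA deg →ₗ[ℚ] FreeGCA deg}
    (hd : IsDifferential deg d) (i : ι) :
    MvPolynomial.constantCoeff (evenProj deg (d (gen deg i))) = 0 :=
  constantCoeff_evenProj (Nat.succ_ne_zero _) (hd.map_gen_mem i)

/-- The ideal of polynomials without constant term. -/
noncomputable abbrev augmentationIdeal (deg : ι → ℕ) : Ideal (EvenPoly deg) :=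
  RingHom.ker MvPolynomial.constantCoeff

end FreeGCA

namespace TwoStageMinimalModel

open FreeGCA

/-- The two alternative hypotheses on the degrees of `U`. -/
def ConnectivityCondition (M : TwoStageMinimalModel) : Prop :=
  (∃ r : ℤ, M.UOddConnected (2 * r - 1) ∧ M.UEvenCoconnected (2 * r + 2)) ∨
    (∃ s : ℤ, M.UOddCoconnected (2 * s + 1) ∧ M.UEvenConnected (4 * s - 4))

section extension

variable {M : TwoStageMinimalModel} {n : ℕ}

/-- The degrees of the generators of `ΛAₙ ⊗ Λ(U, V)`. -/
abbrev totalDeg (M : TwoStageMinimalModel) (n : ℕ) :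
    Fin n ⊕ (Fin M.dimU ⊕ Fin M.dimV) → ℕ :=
  Sum.elim (fun _ => 2) M.deg

variable {D : FreeGCA (M.totalDeg n) →ₗ[ℚ] FreeGCA (M.totalDeg n)}

theorem map_gen_base (hD : IsKSExtension (0 : FreeGCA (fun _ : Fin n => 2) →ₗ[ℚ] _) M.d D)
    (a : Fin n) : D (gen (M.totalDeg n) (Sum.inl a)) = 0 := by
  have := hD.base (gen _ a)
  simpa using this

/-- On a generator of the fibre, `D` and `d` differ by homogeneous monomials that contain a
generator of the base. -/
theorem map_gen_fibre_sub_mem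
    (hD : IsKSExtension (0 : FreeGCA (fun _ : Fin n => 2) →ₗ[ℚ] _) M.d D)
    (i : Fin M.dimU ⊕ Fin M.dimV) :
    D (gen (M.totalDeg n) (Sum.inr i)) - fibreSection _ _ (M.d (gen M.deg i)) ∈
      monomialSpan (M.totalDeg n) fun l =>
        (l.map (M.totalDeg n)).sum = M.deg i + 1 ∧ ∃ a, Sum.inl a ∈ l := by
  have h := sub_fibreSection_mem (hD.isDifferential.map_gen_mem (Sum.inr i))
  rwa [hD.fibre, fibreProjection_gen_inr] at h

/-- The part of `Dx`, for `x` in `U`, that is linear in the odd generators does not involve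
generators of degree at least `|x|`: every monomial in `Dx` contains a base generator. -/
theorem oddCoeff_map_gen_eq_zero
    (hD : IsKSExtension (0 : FreeGCA (fun _ : Fin n => 2) →ₗ[ℚ] _) M.d D)
    {x k : Fin M.dimU} (h : M.degU x ≤ M.degU k) :
    oddCoeff (M.totalDeg n) (Sum.inr (Sum.inl k))
      (D (gen (M.totalDeg n) (Sum.inr (Sum.inl x)))) = 0 := by
  have hmem := map_gen_fibre_sub_mem hD (Sum.inl x)
  rw [M.d_U, map_zero, sub_zero] at hmem
  refine map_mem_of_list_prod (oddCoeff (M.totalDeg n) (Sum.inr (Sum.inl k))) ⊥ ?_ hmem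
  rintro l ⟨hsum, a, ha⟩
  by_cases hk : Sum.inr (Sum.inl k) ∈ l
  · exfalso
    obtain ⟨l', hperm, -⟩ := exists_list_prod_eq_gen_mul (deg := M.totalDeg n) even_two ha
    have hk' : Sum.inr (Sum.inl k) ∈ l' := by
      have := hperm.mem_iff.mp hk
      simpa using this
    have h1 := List.single_le_sum (l := l'.map (M.totalDeg n)) (by simp) _
      (List.mem_map_of_mem hk')
    have h2 := (hperm.map (M.totalDeg n)).sum_eq
    simp only [List.map_cons, List.sum_cons, Sum.elim_inl, Sum.elim_inr] at h1 h2 hsum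
    omega
  · exact oddCoeff_list_prod_of_notMem hk

/-- The linear relations, modulo `m J`, between the even parts of the differentials of the odd
generators of `U` that result from `D² v = 0` for `v` in `V`. They are the terms of `D² v` that are
linear in the odd generator `k` of `U`; the degree conditions serve to show that nothing else
contributes to these terms outside `m J`. -/
theorem sum_smul_evenProj_mem
    (hD : IsKSExtension (0 : FreeGCA (fun _ : Fin n => 2) →ₗ[ℚ] _) M.d D)
    (hconn : M.ConnectivityCondition) (hV : ∀ j, Odd (M.degV j))
    {c : Fin M.dimV → Fin M.dimU → Fin M.dimU → ℚ}
    (hc : ∀ j i k, c j i k ≠ 0 → M.degU i + M.degU k = M.degV j + 1)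
    (hdc : ∀ j, M.d (gen M.deg (Sum.inr j)) =
      ∑ i, ∑ k, c j i k • (gen M.deg (Sum.inl i) * gen M.deg (Sum.inl k)))
    (j : Fin M.dimV) {k : Fin M.dimU} (hk : Odd (M.degU k)) :
    ∑ i, (c j i k - c j k i) •
        evenProj (M.totalDeg n) (D (gen (M.totalDeg n) (Sum.inr (Sum.inl i)))) ∈
      augmentationIdeal (M.totalDeg n) * evenIdeal D := by
  classical
  have hdD := hD.isDifferential
  by_cases hrow : ∀ i, c j i k - c j k i = 0
  · simp [hrow]
  push Not at hrow
  obtain ⟨i₁, hi₁⟩ := hrow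
  have hdeg : M.degU i₁ + M.degU k = M.degV j + 1 := by
    by_cases h : c j i₁ k = 0
    · have h' : c j k i₁ ≠ 0 := by rintro h'; simp [h, h'] at hi₁
      rw [add_comm]; exact hc j k i₁ h'
    · exact hc j i₁ k h
  have hi₁odd : Odd (M.degU i₁) := by
    have h1 := hV j
    rw [Nat.odd_iff] at *
    omega
  -- for degree reasons `dv` is a combination of products of odd generators
  have hodd (i l) (h : c j i l ≠ 0) : Odd (M.degU i) ∧ Odd (M.degU l) := by
    have h1 := hc j i l h
    by_contra hcon
    have h2 := hV j
    have hi : Even (M.degU i) := by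
      by_contra hi; rw [Nat.not_even_iff_odd] at hi; apply hcon
      refine ⟨hi, ?_⟩
      rw [Nat.odd_iff] at *; omega
    have hl : Even (M.degU l) := by
      rw [Nat.odd_iff] at h2; rw [Nat.even_iff] at *; omega
    rcases hconn with ⟨r, hr₁, hr₂⟩ | ⟨s, hs₁, hs₂⟩
    · have := hr₁ i₁ hi₁odd; have := hr₁ k hk; have := hr₂ i hi; have := hr₂ l hl
      rw [Nat.odd_iff] at hk hi₁odd; rw [Nat.even_iff] at hi hl
      omega
    · have := hs₁ i₁ hi₁odd; have := hs₁ k hk; have := hs₂ i hi; have := hs₂ l hl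
      rw [Nat.odd_iff] at hk hi₁odd; rw [Nat.even_iff] at hi hl
      omega
  -- the part of `Dv` that involves the base contributes an element of `m J`
  have hrest : oddCoeff (M.totalDeg n) (Sum.inr (Sum.inl k)) (D
      (D (gen (M.totalDeg n) (Sum.inr (Sum.inr j))) -
        fibreSection _ _ (M.d (gen M.deg (Sum.inr j))))) ∈
      augmentationIdeal (M.totalDeg n) * evenIdeal D := by
    refine map_mem_of_list_prod (oddCoeff (M.totalDeg n) (Sum.inr (Sum.inl k)) ∘ₗ D)
      ((augmentationIdeal (M.totalDeg n) * evenIdeal D).restrictScalars ℚ) ?_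
      (map_gen_fibre_sub_mem hD (Sum.inr j))
    rintro l ⟨hsum, a, ha⟩
    obtain ⟨l', hperm, hprod⟩ := exists_list_prod_eq_gen_mul (deg := M.totalDeg n) even_two ha
    have h2 := (hperm.map (M.totalDeg n)).sum_eq
    simp only [List.map_cons, List.sum_cons, Sum.elim_inl, Sum.elim_inr] at h2 hsum
    have hl'even : Even (l'.map (M.totalDeg n)).sum := by
      have := hV j
      rw [Nat.odd_iff] at this; rw [Nat.even_iff]; omega
    have ha2 : Even (M.totalDeg n (Sum.inl a)) := even_two
    simp only [LinearMap.comp_apply, Submodule.restrictScalars_mem]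
    rw [hprod, hdD.map_gen_mul_of_even ha2, map_gen_base hD, zero_mul, zero_add, oddCoeff_mul,
      oddCoeff_gen_of_even ha2, zero_mul, zero_add]
    refine Ideal.mul_mem_mul ?_ ?_
    · rw [evenProj_gen_of_even ha2]
      exact MvPolynomial.constantCoeff_X _ _
    refine hdD.oddCoeff_list_prod_mem _ hdD.evenProj_mem hl'even ?_
    rintro (b | x | v) hmem hx
    · rw [map_gen_base hD, map_zero]
      exact Ideal.zero_mem _
    · have hx : Even (M.degU x) := hx
      have h1 := List.single_le_sum (l := l'.map (M.totalDeg n)) (by simp) _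
        (List.mem_map_of_mem hmem)
      simp only [Sum.elim_inl, Sum.elim_inr] at h1
      rw [oddCoeff_map_gen_eq_zero hD]
      · exact Ideal.zero_mem _
      rcases hconn with ⟨r, hr₁, hr₂⟩ | ⟨s, hs₁, hs₂⟩
      · have := hr₁ k hk; have := hr₂ x hx
        rw [Nat.odd_iff] at hk; rw [Nat.even_iff] at hx
        omega
      · -- `x` cannot occur: its degree exceeds that of the monomial
        exfalso
        have := hs₁ i₁ hi₁odd; have := hs₁ k hk; have := hs₂ x hx
        rw [Nat.odd_iff] at hk hi₁odd; rw [Nat.even_iff] at hx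
        omega
    · exact absurd hx (Nat.not_even_iff_odd.mpr (hV v))
  rw [map_sub, hdD.sq_zero, zero_sub, map_neg, neg_mem_iff, hdc j] at hrest
  convert hrest using 1
  simp only [map_sum, map_smul, map_mul, fibreSection_gen]
  have hterm (i l) : c j i l • oddCoeff (M.totalDeg n) (Sum.inr (Sum.inl k))
      (D (gen (M.totalDeg n) (Sum.inr (Sum.inl i)) * gen (M.totalDeg n) (Sum.inr (Sum.inl l)))) =
      (if l = k then c j i l •
        evenProj (M.totalDeg n) (D (gen (M.totalDeg n) (Sum.inr (Sum.inl i)))) else 0) -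
      (if i = k then c j i l •
        evenProj (M.totalDeg n) (D (gen (M.totalDeg n) (Sum.inr (Sum.inl l)))) else 0) := by
    by_cases h : c j i l = 0
    · simp [h]
    obtain ⟨hi, hl⟩ := hodd i l h
    have hcoeff (x : Fin M.dimU) : oddCoeff (M.totalDeg n) (Sum.inr (Sum.inl k))
        (gen (M.totalDeg n) (Sum.inr (Sum.inl x))) = if x = k then 1 else 0 := by
      by_cases hx : x = k
      · rw [if_pos hx, hx]; exact oddCoeff_gen_self hk
      · rw [if_neg hx]; exact oddCoeff_gen_of_ne (by simpa using hx)
    have hi' : Odd (M.totalDeg n (Sum.inr (Sum.inl i))) := hi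
    have hl' : Odd (M.totalDeg n (Sum.inr (Sum.inl l))) := hl
    rw [hdD.map_gen_mul_of_odd hi', map_sub, oddCoeff_mul, oddCoeff_mul, evenProj_gen_of_odd hi',
      evenProj_gen_of_odd hl', hcoeff, hcoeff, mul_zero, zero_mul, zero_add, add_zero, smul_sub]
    split_ifs <;> simp
  simp only [hterm, Finset.sum_sub_distrib, Finset.sum_ite_eq', Finset.mem_univ, if_true]
  rw [Finset.sum_comm (f := fun i l => if i = k then c j i l •
        evenProj (M.totalDeg n) (D (gen (M.totalDeg n) (Sum.inr (Sum.inl l)))) else 0)]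
  simp [sub_smul, Finset.sum_sub_distrib]

end extension

end TwoStageMinimalModel

/-! ### Counting generators -/

namespace FreeGCA

variable {ι : Type*} {deg : ι → ℕ}

/-- A generator of even degree that is a cocycle satisfies a polynomial relation modulo
coboundaries if the cohomology is finite-dimensional. -/
theorem IsDifferential.exists_aeval_gen_eq {d : FreeGCA deg →ₗ[ℚ] FreeGCA deg}
    (hd : IsDifferential deg d) (hfin : Module.Finite ℚ (Cohomology d)) {i : ι}
    (hi : Even (deg i)) (h : d (gen deg i) = 0) :
    ∃ p : Polynomial ℚ, p ≠ 0 ∧ ∃ η, d η = Polynomial.aeval (gen deg i) p := by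
  obtain ⟨p, hp, η, hη⟩ := exists_aeval_mem_range d (LinearMap.mulLeft ℚ (gen deg i))
    (cocycleClasses_fg d hfin) 1 hd.map_one fun z => by
      rw [LinearMap.mulLeft_apply, LinearMap.mulLeft_apply, hd.map_gen_mul_of_even hi, h,
        zero_mul, zero_add]
  refine ⟨p, hp, η, hη.trans ?_⟩
  have h1 := Polynomial.aeval_algHom_apply (Algebra.lmul ℚ (FreeGCA deg)) (gen deg i) p
  exact (LinearMap.congr_fun h1 1).trans (mul_one _)

end FreeGCA

namespace TwoStageMinimalModel

open FreeGCA

variable {M : TwoStageMinimalModel}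

theorem card_even_totalDeg (hV : ∀ j, Odd (M.degV j)) (n : ℕ) :
    Fintype.card {i // Even (M.totalDeg n i)} = n + M.dimUEven := by
  have hV' (j) : ¬ Even (M.degV j) := Nat.not_even_iff_odd.mpr (hV j)
  rw [Fintype.card_subtype, dimUEven, Finset.card_filter, Finset.card_filter, Fintype.sum_sum_type,
    Fintype.sum_sum_type]
  simp only [Sum.elim_inl, Sum.elim_inr, even_two, hV', if_true, if_false, Finset.sum_const_zero,
    add_zero, Finset.sum_const, Finset.card_univ, Fintype.card_fin, smul_eq_mul, mul_one]
  exact congrArg (n + ·) (Finset.sum_congr rfl fun _ _ => if_congr Iff.rfl rfl rfl)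

theorem card_even_deg (hV : ∀ j, Odd (M.degV j)) :
    Fintype.card {i // Even (M.deg i)} = M.dimUEven := by
  have hV' (j) : ¬ Even (M.degV j) := Nat.not_even_iff_odd.mpr (hV j)
  rw [Fintype.card_subtype, dimUEven, Finset.card_filter, Finset.card_filter, Fintype.sum_sum_type]
  simp only [Sum.elim_inl, Sum.elim_inr, hV', if_false, Finset.sum_const_zero, add_zero]
  exact Finset.sum_congr rfl fun _ _ => if_congr Iff.rfl rfl rfl

/-- The case of the trivial torus: even generators of `U` are nilpotent modulo the ideal generated by
the even parts of `dV`. -/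
theorem IsElliptic.dimUEven_le (hell : M.IsElliptic) (hV : ∀ j, Odd (M.degV j)) :
    M.dimUEven ≤ M.dimV := by
  have hd := M.isDifferential
  have h := MvPolynomial.card_le_card_of_isolated
    (fun j : Fin M.dimV => evenProj M.deg (M.d (gen M.deg (Sum.inr j))))
    (fun j => hd.constantCoeff_evenProj_gen (Sum.inr j)) ?_
  · rwa [card_even_deg hV, Fintype.card_fin] at h
  rintro q hq hqm hg ⟨x | j, hx⟩
  · have hJ : evenIdeal M.d ≤ q := by
      refine Ideal.span_le.mpr ?_
      rintro _ ⟨i | j, rfl⟩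
      · simp [M.d_U]
      · exact hg j
    obtain ⟨p, hp, η, hη⟩ := hd.exists_aeval_gen_eq hell hx (M.d_U x)
    refine MvPolynomial.mem_of_aeval_mem hq hqm (MvPolynomial.constantCoeff_X _ _) hp ?_
    rw [← evenProj_gen_of_even hx, Polynomial.aeval_algHom_apply, ← hη]
    exact hJ (hd.evenProj_mem η)
  · exact absurd hx (Nat.not_even_iff_odd.mpr (hV j))

section extension

variable {n : ℕ} {D : FreeGCA (M.totalDeg n) →ₗ[ℚ] FreeGCA (M.totalDeg n)}

/-- The even parts of the differentials of the odd generators of `U` lie in `m J`: by maximality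
of `V`, the relations of `sum_smul_evenProj_mem` can be solved for them. -/
theorem evenProj_map_gen_mem (hV : ∀ j, Odd (M.degV j)) (hquad : M.IsQuadratic)
    (hmax : M.HasMaximalV) (hconn : M.ConnectivityCondition)
    (hD : IsKSExtension (0 : FreeGCA (fun _ : Fin n => 2) →ₗ[ℚ] _) M.d D)
    {i₀ : Fin M.dimU} (hi₀ : Odd (M.degU i₀)) :
    evenProj (M.totalDeg n) (D (gen (M.totalDeg n) (Sum.inr (Sum.inl i₀)))) ∈
      augmentationIdeal (M.totalDeg n) * evenIdeal D := by
  choose c hc hdc using hquad.exists_coeff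
  let Φ : (Fin M.dimU → ℚ) →ₗ[ℚ] EvenPoly (M.totalDeg n) :=
    Fintype.linearCombination ℚ fun i =>
      evenProj (M.totalDeg n) (D (gen (M.totalDeg n) (Sum.inr (Sum.inl i))))
  have hle : Submodule.span ℚ {w | ∃ j k, Odd (M.degU k) ∧ w = fun i => c j i k - c j k i} ≤
      ((augmentationIdeal (M.totalDeg n) * evenIdeal D).restrictScalars ℚ).comap Φ := by
    rw [Submodule.span_le]
    rintro _ ⟨j, k, hk, rfl⟩
    exact sum_smul_evenProj_mem hD hconn hV hc hdc j hk
  have h : Φ (Pi.single i₀ 1) ∈ augmentationIdeal (M.totalDeg n) * evenIdeal D :=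
    hle (hmax.single_mem_span hV c hc hdc i₀ hi₀)
  have hΦ : Φ (Pi.single i₀ 1) =
      evenProj (M.totalDeg n) (D (gen (M.totalDeg n) (Sum.inr (Sum.inl i₀)))) := by
    simp [Φ, Fintype.linearCombination_apply_single]
  rwa [hΦ] at h

theorem evenIdeal_le (hV : ∀ j, Odd (M.degV j)) (hquad : M.IsQuadratic)
    (hmax : M.HasMaximalV) (hconn : M.ConnectivityCondition)
    (hD : IsKSExtension (0 : FreeGCA (fun _ : Fin n => 2) →ₗ[ℚ] _) M.d D) :
    evenIdeal D ≤ Ideal.span (Set.range fun j : Fin M.dimV =>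
        evenProj (M.totalDeg n) (D (gen (M.totalDeg n) (Sum.inr (Sum.inr j))))) ⊔
      augmentationIdeal (M.totalDeg n) * evenIdeal D := by
  refine Ideal.span_le.mpr ?_
  rintro _ ⟨a | x | j, rfl⟩
  · dsimp only
    rw [map_gen_base hD, map_zero]
    exact Submodule.zero_mem _
  · rcases Nat.even_or_odd (M.degU x) with hx | hx
    · have h0 : evenProj (M.totalDeg n) (D (gen (M.totalDeg n) (Sum.inr (Sum.inl x)))) = 0 :=
        evenProj_of_odd (k := M.degU x + 1) hx.add_one
          (hD.isDifferential.map_gen_mem (Sum.inr (Sum.inl x)))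
      dsimp only
      rw [h0]
      exact Submodule.zero_mem _
    · exact Submodule.mem_sup_right (evenProj_map_gen_mem hV hquad hmax hconn hD hx)
  · exact Submodule.mem_sup_left (Ideal.subset_span ⟨j, rfl⟩)

/-- By Nakayama's lemma, near the origin the zero set of `J` is cut out by the even parts of the
differentials of the generators of `V`. -/
theorem evenIdeal_le_of_isPrime (hV : ∀ j, Odd (M.degV j)) (hquad : M.IsQuadratic)
    (hmax : M.HasMaximalV) (hconn : M.ConnectivityCondition)
    (hD : IsKSExtension (0 : FreeGCA (fun _ : Fin n => 2) →ₗ[ℚ] _) M.d D)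
    {q : Ideal (EvenPoly (M.totalDeg n))} (hq : q.IsPrime)
    (hqm : q ≤ augmentationIdeal (M.totalDeg n))
    (hg : ∀ j, evenProj (M.totalDeg n) (D (gen (M.totalDeg n) (Sum.inr (Sum.inr j)))) ∈ q) :
    evenIdeal D ≤ q := by
  have hJfg : (evenIdeal D).FG := Submodule.fg_span (Set.finite_range _)
  obtain ⟨r, hr, hrJ⟩ := Submodule.exists_sub_one_mem_and_smul_le_of_fg_of_le_sup hJfg le_rfl
    (evenIdeal_le hV hquad hmax hconn hD)
  have hrq : r ∉ q := by
    intro hrq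
    have h1 : MvPolynomial.constantCoeff r = 0 := hqm hrq
    have h2 : MvPolynomial.constantCoeff (r - 1) = 0 := hr
    rw [map_sub, h1, map_one] at h2
    norm_num at h2
  intro z hz
  have h2 := Ideal.span_le.mpr (Set.range_subset_iff.mpr hg)
  exact (hq.mem_or_mem (h2 (hrJ (Submodule.smul_mem_pointwise_smul z r _ hz)))).resolve_left hrq

/-- If `ΛAₙ ⊗ Λ(U, V)` has finite-dimensional cohomology, the origin is an isolated zero of the even
parts of `DV`: first the base generators vanish there, since their powers are coboundaries, then
the even generators of `U`, by ellipticity of the fibre. -/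
theorem add_dimUEven_le (hell : M.IsElliptic) (hquad : M.IsQuadratic) (hmax : M.HasMaximalV)
    (hconn : M.ConnectivityCondition)
    (hD : IsKSExtension (0 : FreeGCA (fun _ : Fin n => 2) →ₗ[ℚ] _) M.d D)
    (hfin : Module.Finite ℚ (Cohomology D)) : n + M.dimUEven ≤ M.dimV := by
  have hV := hell.odd_degV hquad
  have hdD := hD.isDifferential
  have h := MvPolynomial.card_le_card_of_isolated
    (fun j : Fin M.dimV =>
      evenProj (M.totalDeg n) (D (gen (M.totalDeg n) (Sum.inr (Sum.inr j)))))
    (fun j => hdD.constantCoeff_evenProj_gen _) ?_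
  · rwa [card_even_totalDeg hV, Fintype.card_fin] at h
  intro q hq hqm hg
  have hJq := evenIdeal_le_of_isPrime hV hquad hmax hconn hD hq hqm hg
  have hbase (a : Fin n) : MvPolynomial.X ⟨Sum.inl a, even_two⟩ ∈ q := by
    have ha : Even (M.totalDeg n (Sum.inl a)) := even_two
    obtain ⟨p, hp, η, hη⟩ := hdD.exists_aeval_gen_eq hfin ha (map_gen_base hD a)
    refine MvPolynomial.mem_of_aeval_mem hq hqm (MvPolynomial.constantCoeff_X _ _) hp ?_
    rw [← evenProj_gen_of_even ha, Polynomial.aeval_algHom_apply, ← hη]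
    exact hJq (hdD.evenProj_mem η)
  rintro ⟨a | x | j, hx⟩
  · exact hbase a
  · -- lift a relation in the fibre; the error term lies in the ideal of the base generators
    have hx' : Even (M.deg (Sum.inl x)) := hx
    obtain ⟨p, hp, η, hη⟩ := M.isDifferential.exists_aeval_gen_eq hell hx' (M.d_U x)
    refine MvPolynomial.mem_of_aeval_mem hq hqm (MvPolynomial.constantCoeff_X _ _) hp ?_
    have hsub := sub_fibreSection_mem (deg₁ := fun _ : Fin n => 2) (deg₂ := M.deg)
      (P := fun _ => True) (z := D (fibreSection _ _ η)) (by rw [monomialSpan_true]; trivial)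
    rw [hD.fibre, fibreProjection_fibreSection, hη] at hsub
    have herr := map_mem_of_list_prod (evenProj (M.totalDeg n)).toLinearMap (q.restrictScalars ℚ)
      (by
        rintro l ⟨-, a, ha⟩
        obtain ⟨l', -, hprod⟩ := exists_list_prod_eq_gen_mul (deg := M.totalDeg n) even_two ha
        have ha2 : Even (M.totalDeg n (Sum.inl a)) := even_two
        rw [hprod, AlgHom.toLinearMap_apply, map_mul, evenProj_gen_of_even ha2]
        exact q.mul_mem_right _ (hbase a)) hsub
    rw [AlgHom.toLinearMap_apply, Submodule.restrictScalars_mem, map_sub] at herr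
    have h1 := (Submodule.sub_mem_iff_right q (hJq (hdD.evenProj_mem _))).mp herr
    rw [← Polynomial.aeval_algHom_apply, ← Polynomial.aeval_algHom_apply, fibreSection_gen,
      evenProj_gen_of_even hx] at h1
    exact h1
  · exact absurd hx (Nat.not_even_iff_odd.mpr (hV j))

end extension

end TwoStageMinimalModel

theorem mainTheorem2 (M : TwoStageMinimalModel) (hell : M.IsElliptic) (hquad : M.IsQuadratic)
    (hmax : M.HasMaximalV)
    (hconn : (∃ r : ℤ, M.UOddConnected (2 * r - 1) ∧ M.UEvenCoconnected (2 * r + 2)) ∨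
      (∃ s : ℤ, M.UOddCoconnected (2 * s + 1) ∧ M.UEvenConnected (4 * s - 4))) :
    FreeGCA.rationalToralRank M.d + (M.dimUEven : ℕ∞) ≤ (M.dimV : ℕ∞) := by
  have h0 : M.dimUEven ≤ M.dimV := hell.dimUEven_le (hell.odd_degV hquad)
  have hle : FreeGCA.rationalToralRank M.d ≤ ((M.dimV - M.dimUEven : ℕ) : ℕ∞) := by
    refine sSup_le ?_
    rintro _ ⟨n, rfl, D, hD, hfin⟩
    have h := TwoStageMinimalModel.add_dimUEven_le hell hquad hmax hconn hD hfin
    exact_mod_cast Nat.le_sub_of_add_le h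
  calc FreeGCA.rationalToralRank M.d + (M.dimUEven : ℕ∞)
      ≤ ((M.dimV - M.dimUEven : ℕ) : ℕ∞) + (M.dimUEven : ℕ∞) := add_le_add_left hle _
    _ = (M.dimV : ℕ∞) := by
      rw [← Nat.cast_add, Nat.sub_add_cancel h0]
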